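/- Let $G=(V,E)$ be a finite simple undirected graph with nonnegative rational edge costs $\{c(e):e\in E\}$ and degree bounds $r(v)\in\mathbb{Z}_{\ge 0}$, $v\in V$. For $J\subseteq E$ and $v\in V$ let $\delta_J(v)$ be the set of edges of $J$ incident to $v$; the power of $v$ is $p_J(v)=\max_{e\in\delta_J(v)}c(e)$ if $\delta_J(v)\neq\emptyset$ and $p_J(v)=0$ otherwise, and the power of $J$ is $p_J(V)=\sum_{v\in V}p_J(v)$. The set $J$ is an $r$-edge cover if $|\delta_J(v)|\ge r(v)$ for every $v\in V$. The Minimum-Power Edge-Multi-Cover problem is: given $(G,c,r)$, find an $r$-edge cover $J\subseteq E$ of minimum power. Let $k=\max_{v\in V}r(v)$. Theorem. Minimum-Power Edge-Multi-Cover admits a polynomial-time $O(\log k)$-approximation algorithm. That is, there are an absolute constant $C>0$ and a deterministic algorithm that halts on every instance within time polynomial in the bit length of the instance and that, on every instance that has an $r$-edge cover, returns an $r$-edge cover $J\subseteq E$ with $$p_J(V)\ \le\ C\,\log(k+1)\cdot p_F(V)\qquad\text{for every } r\text{-edge cover } F\subseteq E .$$ -/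

import Mathlib

/-! Programs over tree-structured data with a bit-cost semantics. -/

namespace TreeProg

/-- Data: finite binary trees whose leaves are natural numbers. -/
inductive Val : Type
  | num (n : ℕ) : Val
  | pair (a b : Val) : Val

/-- Number of bits of a datum: numbers are written in binary, plus one unit for every tree node. -/
def Val.size : Val → ℕ
  | .num n => Nat.size n + 1
  | .pair a b => a.size + b.size + 1

/-- A list as nested pairs, ended by the leaf `0`. -/
def Val.ofList : List Val → Val
  | [] => .num 0
  | a :: l => .pair a (Val.ofList l)

/-- The elementary operations. -/
inductive Op : Type
  | const (n : ℕ) : Op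
  | id : Op
  | fst : Op
  | snd : Op
  | isPair : Op
  | add : Op
  | sub : Op
  | mul : Op
  | div : Op

/-- The result of an elementary operation; an operation that is applied to data of the wrong shape
returns `0`. Subtraction is truncated, division is rounded down (division by `0` gives `0`). -/
def Op.apply : Op → Val → Val
  | .const n, _ => .num n
  | .id, x => x
  | .fst, .pair a _ => a
  | .snd, .pair _ b => b
  | .isPair, .pair _ _ => .num 1
  | .add, .pair (.num a) (.num b) => .num (a + b)
  | .sub, .pair (.num a) (.num b) => .num (a - b)
  | .mul, .pair (.num a) (.num b) => .num (a * b)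
  | .div, .pair (.num a) (.num b) => .num (a / b)
  | _, _ => .num 0

/-- Programs. A program transforms one datum into another one. -/
inductive Prog : Type
  /-- an elementary operation -/
  | op (o : Op) : Prog
  /-- first `f`, then `g` -/
  | seq (f g : Prog) : Prog
  /-- run `f` and `g` on the same input and pair the results -/
  | pair (f g : Prog) : Prog
  /-- if the result of `c` is not the leaf `0` then `f` else `g` -/
  | ite (c f g : Prog) : Prog
  /-- while the result of `c` is not the leaf `0` replace the datum by the result of `f` -/
  | loop (c f : Prog) : Prog

/-- `Runs P x y t`: the program `P` halts on input `x` with output `y` after time `t`.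
Every elementary action is charged one unit plus the number of bits of the data it reads
and writes. -/
inductive Runs : Prog → Val → Val → ℕ → Prop
  | op (o : Op) (x : Val) :
      Runs (.op o) x (o.apply x) (1 + x.size + (o.apply x).size)
  | seq {f g : Prog} {x y z : Val} {s t : ℕ} (hf : Runs f x y s) (hg : Runs g y z t) :
      Runs (.seq f g) x z (1 + s + t)
  | pair {f g : Prog} {x y z : Val} {s t : ℕ} (hf : Runs f x y s) (hg : Runs g x z t) :
      Runs (.pair f g) x (.pair y z) (1 + x.size + (Val.pair y z).size + s + t)
  | ite_true {c f g : Prog} {x b y : Val} {s t : ℕ} (hc : Runs c x b s) (hb : b ≠ .num 0)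
      (hf : Runs f x y t) : Runs (.ite c f g) x y (1 + x.size + s + t)
  | ite_false {c f g : Prog} {x y : Val} {s t : ℕ} (hc : Runs c x (.num 0) s)
      (hg : Runs g x y t) : Runs (.ite c f g) x y (1 + x.size + s + t)
  | loop_done {c f : Prog} {x : Val} {s : ℕ} (hc : Runs c x (.num 0) s) :
      Runs (.loop c f) x x (1 + x.size + s)
  | loop_step {c f : Prog} {x b y z : Val} {s t u : ℕ} (hc : Runs c x b s) (hb : b ≠ .num 0)
      (hf : Runs f x y t) (hl : Runs (.loop c f) y z u) :
      Runs (.loop c f) x z (1 + x.size + s + t + u)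

/-- Programs are deterministic: output and running time are determined by the input. -/
theorem Runs.det {P : Prog} {x y : Val} {t : ℕ} (h : Runs P x y t) :
    ∀ {y' : Val} {t' : ℕ}, Runs P x y' t' → y = y' ∧ t = t' := by
  induction h with
  | op o x => intro y' t' h'; cases h'; exact ⟨rfl, rfl⟩
  | seq hf hg ihf ihg =>
    intro y' t' h'
    cases h' with
    | seq hf' hg' =>
      obtain ⟨rfl, rfl⟩ := ihf hf'
      obtain ⟨rfl, rfl⟩ := ihg hg'
      exact ⟨rfl, rfl⟩
  | pair hf hg ihf ihg =>
    intro y' t' h'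
    cases h' with
    | pair hf' hg' =>
      obtain ⟨rfl, rfl⟩ := ihf hf'
      obtain ⟨rfl, rfl⟩ := ihg hg'
      exact ⟨rfl, rfl⟩
  | ite_true hc hb hf ihc ihf =>
    intro y' t' h'
    cases h' with
    | ite_true hc' hb' hf' =>
      obtain ⟨rfl, rfl⟩ := ihc hc'
      obtain ⟨rfl, rfl⟩ := ihf hf'
      exact ⟨rfl, rfl⟩
    | ite_false hc' hg' => exact absurd (ihc hc').1 hb
  | ite_false hc hg ihc ihg =>
    intro y' t' h'
    cases h' with
    | ite_true hc' hb' hf' => exact absurd (ihc hc').1.symm hb'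
    | ite_false hc' hg' =>
      obtain ⟨-, rfl⟩ := ihc hc'
      obtain ⟨rfl, rfl⟩ := ihg hg'
      exact ⟨rfl, rfl⟩
  | loop_done hc ihc =>
    intro y' t' h'
    cases h' with
    | loop_done hc' =>
      obtain ⟨-, rfl⟩ := ihc hc'
      exact ⟨rfl, rfl⟩
    | loop_step hc' hb' hf' hl' => exact absurd (ihc hc').1.symm hb'
  | loop_step hc hb hf hl ihc ihf ihl =>
    intro y' t' h'
    cases h' with
    | loop_done hc' => exact absurd (ihc hc').1 hb
    | loop_step hc' hb' hf' hl' =>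
      obtain ⟨rfl, rfl⟩ := ihc hc'
      obtain ⟨rfl, rfl⟩ := ihf hf'
      obtain ⟨rfl, rfl⟩ := ihl hl'
      exact ⟨rfl, rfl⟩

end TreeProg

/-! Minimum-Power Edge-Multi-Cover. -/

namespace MPEMC

open TreeProg

section EdgeSets

variable {V : Type*} [DecidableEq V]

/-- The edges of `J` that are incident to `v`. -/
def incident (J : Finset (Sym2 V)) (v : V) : Finset (Sym2 V) := {e ∈ J | v ∈ e}

/-- The degree of `v` in the graph with edge set `J`. -/
def degree (J : Finset (Sym2 V)) (v : V) : ℕ := (incident J v).card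

/-- The power of the node `v` in `J`: the largest cost of an edge of `J` incident to `v`,
and `0` if there is none. -/
def nodePower (c : Sym2 V → ℚ≥0) (J : Finset (Sym2 V)) (v : V) : ℚ≥0 := (incident J v).sup c

/-- The power of `J`: the sum of the powers of all nodes. -/
def power [Fintype V] (c : Sym2 V → ℚ≥0) (J : Finset (Sym2 V)) : ℚ≥0 := ∑ v, nodePower c J v

/-- `J` is an `r`-edge cover. -/
def IsEdgeCover (r : V → ℕ) (J : Finset (Sym2 V)) : Prop := ∀ v, r v ≤ degree J v

end EdgeSets

/-- An instance: a simple graph on the nodes `0, …, n - 1`, nonnegative rational edge costs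
(only the values of `c` on edges of `G` matter) and degree bounds. -/
structure Inst where
  n : ℕ
  G : SimpleGraph (Fin n)
  c : Sym2 (Fin n) → ℚ≥0
  r : Fin n → ℕ

namespace Inst

/-- The maximum degree bound (`0` for the graph without nodes). -/
def k (I : Inst) : ℕ := Finset.univ.sup I.r

/-- The feasible solutions: the `r`-edge covers `J ⊆ E`. -/
def IsSolution (I : Inst) (J : Finset (Sym2 (Fin I.n))) : Prop :=
  (J : Set (Sym2 (Fin I.n))) ⊆ I.G.edgeSet ∧ IsEdgeCover I.r J

open Classical in
/-- The edges `uv` of the graph, listed as pairs with `u < v` in lexicographic order. -/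
noncomputable def edgeList (I : Inst) : List (Fin I.n × Fin I.n) :=
  ((List.finRange I.n).product (List.finRange I.n)).filter
    (fun p => decide (p.1 < p.2 ∧ I.G.Adj p.1 p.2))

/-- The input data of an instance: the number of nodes, the list of the degree bounds, and the list
of the edges, each with the numerator and the denominator of its cost. -/
noncomputable def encode (I : Inst) : Val :=
  .pair (.num I.n) (.pair
    (Val.ofList ((List.finRange I.n).map (fun v => .num (I.r v))))
    (Val.ofList (I.edgeList.map (fun p => .pair
      (.pair (.num (p.1 : ℕ)) (.num (p.2 : ℕ)))
      (.pair (.num (I.c s(p.1, p.2)).num) (.num (I.c s(p.1, p.2)).den))))))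

end Inst

/-- The output data for an edge set that is given by a list of pairs of nodes. -/
def encodeEdges {n : ℕ} (l : List (Fin n × Fin n)) : Val :=
  Val.ofList (l.map (fun p => .pair (.num (p.1 : ℕ)) (.num (p.2 : ℕ))))

/-- `P` is a polynomial-time `ρ`-approximation algorithm for Minimum-Power Edge-Multi-Cover:
on every instance it halts within time polynomial in the number of bits of the instance,
and if the instance has a feasible solution, then it outputs (in the form of a list of pairs of
nodes) a feasible solution `J` whose power is at most `ρ` times the power of
any feasible solution. -/
def IsPolyTimeApprox (P : Prog) (ρ : Inst → ℝ) : Prop :=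
  ∃ p : Polynomial ℕ, ∀ I : Inst, ∃ (y : Val) (t : ℕ),
    Runs P I.encode y t ∧ t ≤ p.eval I.encode.size ∧
    ((∃ F, I.IsSolution F) →
      ∃ l : List (Fin I.n × Fin I.n), y = encodeEdges l ∧
        ∃ J : Finset (Sym2 (Fin I.n)), J = (l.map (fun p => s(p.1, p.2))).toFinset ∧
          I.IsSolution J ∧
          ∀ F, I.IsSolution F → (power I.c J : ℝ) ≤ ρ I * (power I.c F : ℝ))

end MPEMC

/-! Functions that are computable in polynomial time. -/

namespace TreeProg

/-! Scale the costs to integers and let `w v` be the cost of the `r v`-th cheapest edge at `v`. It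
is at most the power of `v` in any cover `F` (`weight_le`). The potential of `J` is the sum of `w v`
times the residual bound of `v`; for the empty set it is at most `k * opt`, where `opt` is the power
of `F`.

The algorithm keeps a threshold `q`, initially `k`. A star with centre `a` and level `ℓ` consists of
unchosen edges `ab` of cost at most `ℓ`, to deficient nodes `b`, such that `q` times the cost is at
most `w b` times the residual bound of `b`. It is good if it is nonempty and its leaves have total
weight at least `ℓ * q`. Good stars are added while they exist; otherwise `q` is halved.

Every leaf gains a new edge, so a good star lowers the potential by at least `ℓ * q`, which pays for
its centre. The leaves are paid by the potential at the start of the phase, once per node because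
power is a maximum. So `q` times the power added in a phase is at most twice that potential. Without
good stars the potential is at most `2 * q * opt` (`potential_le_of_no_goodStar`), hence at most `6
* (q / 2) * opt` if a further phase follows, and each phase adds power at most `12 * opt`. There are
`Nat.size k` phases, and at `q = 1` the absence of good stars forces a cover
(`isEdgeCover_of_no_goodStar`).

For the running time, `PolyTime` is closed under the usual list operations and under loops with
polynomially bounded states and a polynomially bounded decreasing measure (`PolyTime.while_loop`).
Each round of the greedy loop adds an edge or shortens `q` by one bit. -/

theorem Runs.size_le {P : Prog} {x y : Val} {t : ℕ} (h : Runs P x y t) : y.size ≤ t := by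
  induction h <;> try simp only [Val.size] at *
  all_goals omega

theorem Val.size_pos (x : Val) : 0 < x.size := by
  cases x <;> simp [Val.size]

theorem eval_mono (p : Polynomial ℕ) {m n : ℕ} (h : m ≤ n) : p.eval m ≤ p.eval n := by
  simp only [Polynomial.eval_eq_sum, Polynomial.sum]
  gcongr

/-- A type whose elements are written as data. -/
class Enc (α : Type*) where
  enc : α → Val

open Enc

instance : Enc ℕ := ⟨Val.num⟩
instance : Enc Bool := ⟨fun b => Val.num (if b then 1 else 0)⟩
instance {α β : Type*} [Enc α] [Enc β] : Enc (α × β) := ⟨fun x => .pair (enc x.1) (enc x.2)⟩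
instance {α : Type*} [Enc α] : Enc (List α) := ⟨fun l => Val.ofList (l.map enc)⟩

/-- The number of bits of an element of an encoded type. -/
def bits {α : Type*} [Enc α] (a : α) : ℕ := (enc a).size

/-- `f` is computed by a program in time polynomial in the number of bits of its argument. -/
def PolyTime {α β : Type*} [Enc α] [Enc β] (f : α → β) : Prop :=
  ∃ (P : Prog) (p : Polynomial ℕ), ∀ a, ∃ t, Runs P (enc a) (enc (f a)) t ∧ t ≤ p.eval (bits a)

/-! ### Sizes of encoded lists and numbers -/

section Bits

variable {α β : Type*} [Enc α] [Enc β]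

theorem bits_pos (a : α) : 0 < bits a := Val.size_pos _

@[simp] theorem enc_nat (n : ℕ) : (enc n : Val) = .num n := rfl
@[simp] theorem enc_pair (x : α × β) : enc x = .pair (enc x.1) (enc x.2) := rfl
@[simp] theorem enc_nil : enc ([] : List α) = .num 0 := rfl
@[simp] theorem enc_cons (a : α) (l : List α) : enc (a :: l) = .pair (enc a) (enc l) := rfl
@[simp] theorem enc_true : enc true = .num 1 := rfl
@[simp] theorem enc_false : enc false = .num 0 := rfl

theorem bits_nat (n : ℕ) : bits n = Nat.size n + 1 := rfl
theorem bits_pair (x : α × β) : bits x = bits x.1 + bits x.2 + 1 := rfl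
theorem bits_nil : bits ([] : List α) = 1 := by simp [bits, Val.size]
theorem bits_cons (a : α) (l : List α) : bits (a :: l) = bits a + bits l + 1 := rfl

theorem length_le_bits (l : List α) : l.length ≤ bits l := by
  induction l with
  | nil => simp
  | cons a l ih => simp only [bits_cons, List.length_cons]; omega

theorem bits_le_of_mem {a : α} {l : List α} (h : a ∈ l) : bits a ≤ bits l := by
  induction l with
  | nil => simp at h
  | cons b l ih =>
    rw [bits_cons]
    rcases List.mem_cons.1 h with rfl | h
    · omega
    · have := ih h; omega

theorem bits_list_le {l : List α} {m : ℕ} (h : ∀ a ∈ l, bits a ≤ m) :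
    bits l ≤ l.length * (m + 1) + 1 := by
  induction l with
  | nil => simp [bits_nil]
  | cons b l ih =>
    have h1 := ih fun a ha => h a (List.mem_cons_of_mem _ ha)
    have h2 := h b List.mem_cons_self
    rw [bits_cons, List.length_cons, Nat.succ_mul]
    omega

/-- Each list ends in a leaf of size one, and concatenation loses one of the two leaves. -/
theorem bits_append (l m : List α) : bits (l ++ m) + 1 = bits l + bits m := by
  induction l with
  | nil => simp [bits_nil]; omega
  | cons a l ih => simp only [bits_cons, List.cons_append]; omega

theorem bits_reverse (l : List α) : bits l.reverse = bits l := by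
  induction l with
  | nil => rfl
  | cons a l ih =>
    have := bits_append l.reverse [a]
    rw [bits_cons, bits_nil] at this
    rw [List.reverse_cons, bits_cons]
    omega

theorem bits_sublist_le {l m : List α} (h : l.Sublist m) : bits l ≤ bits m := by
  induction h with
  | slnil => exact le_rfl
  | cons a _ ih => simp only [bits_cons]; omega
  | cons_cons a _ ih => simp only [bits_cons]; omega

end Bits

theorem size_mul_le (a b : ℕ) : Nat.size (a * b) ≤ Nat.size a + Nat.size b := by
  rw [Nat.size_le, pow_add]
  exact Nat.mul_lt_mul'' (Nat.lt_size_self a) (Nat.lt_size_self b)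

theorem size_add_le (a b : ℕ) : Nat.size (a + b) ≤ Nat.size a + Nat.size b + 1 := by
  rw [Nat.size_le, pow_succ, pow_add]
  have ha := Nat.lt_size_self a
  have hb := Nat.lt_size_self b
  nlinarith [Nat.one_le_two_pow (n := a.size), Nat.one_le_two_pow (n := b.size)]

/-! ### Closure properties of polynomial time -/

namespace PolyTime

variable {α β γ δ : Type*} [Enc α] [Enc β] [Enc γ] [Enc δ]

/-- Writing the output is part of the running time, so a time bound is also a size bound. -/
theorem bits_le {f : α → β} (hf : PolyTime f) :
    ∃ p : Polynomial ℕ, ∀ a, bits (f a) ≤ p.eval (bits a) := by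
  obtain ⟨P, p, h⟩ := hf
  refine ⟨p, fun a => ?_⟩
  obtain ⟨t, ht, hp⟩ := h a
  exact ht.size_le.trans hp

theorem of_op {f : α → β} (o : Op) (h : ∀ a, o.apply (enc a) = enc (f a))
    (p : Polynomial ℕ) (hp : ∀ a, bits (f a) ≤ p.eval (bits a)) : PolyTime f := by
  refine ⟨.op o, 1 + Polynomial.X + p, fun a => ⟨_, h a ▸ Runs.op o (enc a), ?_⟩⟩
  have := hp a
  simp only [Polynomial.eval_add, Polynomial.eval_one, Polynomial.eval_X]
  unfold bits at *
  omega

theorem id : PolyTime (fun a : α => a) :=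
  of_op .id (fun _ => rfl) Polynomial.X (by simp)

theorem comp {g : β → γ} {f : α → β} (hg : PolyTime g) (hf : PolyTime f) :
    PolyTime (fun a => g (f a)) := by
  obtain ⟨P, p, h⟩ := hf
  obtain ⟨Q, q, h'⟩ := hg
  refine ⟨.seq P Q, 1 + p + q.comp p, fun a => ?_⟩
  obtain ⟨s, hs, hs'⟩ := h a
  obtain ⟨t, ht, ht'⟩ := h' (f a)
  refine ⟨_, .seq hs ht, ?_⟩
  have : t ≤ q.eval (p.eval (bits a)) := ht'.trans (eval_mono q (hs.size_le.trans hs'))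
  simp only [Polynomial.eval_add, Polynomial.eval_one, Polynomial.eval_comp]
  omega

theorem pair {f : α → β} {g : α → γ} (hf : PolyTime f) (hg : PolyTime g) :
    PolyTime (fun a => (f a, g a)) := by
  obtain ⟨P, p, h⟩ := hf
  obtain ⟨Q, q, h'⟩ := hg
  refine ⟨.pair P Q, 2 + Polynomial.X + 2 * p + 2 * q, fun a => ?_⟩
  obtain ⟨s, hs, hs'⟩ := h a
  obtain ⟨t, ht, ht'⟩ := h' a
  refine ⟨_, .pair hs ht, ?_⟩
  have h1 := hs.size_le
  have h2 := ht.size_le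
  simp only [Polynomial.eval_add, Polynomial.eval_ofNat, Polynomial.eval_X, Polynomial.eval_mul,
    Val.size]
  rw [bits] at *
  omega

theorem ite {c : α → Bool} {f g : α → β} (hc : PolyTime c) (hf : PolyTime f) (hg : PolyTime g) :
    PolyTime (fun a => if c a then f a else g a) := by
  obtain ⟨R, r, h⟩ := hc
  obtain ⟨P, p, hf⟩ := hf
  obtain ⟨Q, q, hg⟩ := hg
  refine ⟨.ite R P Q, 1 + Polynomial.X + r + p + q, fun a => ?_⟩
  obtain ⟨u, hu, hu'⟩ := h a
  simp only [Polynomial.eval_add, Polynomial.eval_one, Polynomial.eval_X]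
  cases hca : c a with
  | true =>
    obtain ⟨s, hs, hs'⟩ := hf a
    refine ⟨_, .ite_true hu (by simp [hca]) (by simpa using hs), ?_⟩
    rw [bits] at *
    omega
  | false =>
    obtain ⟨s, hs, hs'⟩ := hg a
    refine ⟨_, .ite_false (by simpa [hca] using hu) (by simpa using hs), ?_⟩
    rw [bits] at *
    omega

theorem fst {f : α → β × γ} (hf : PolyTime f) : PolyTime (fun a => (f a).1) :=
  comp (g := fun x : β × γ => x.1)
    (of_op .fst (fun _ => rfl) Polynomial.X (by simp [bits_pair]; intros; omega)) hf

theorem snd {f : α → β × γ} (hf : PolyTime f) : PolyTime (fun a => (f a).2) :=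
  comp (g := fun x : β × γ => x.2)
    (of_op .snd (fun _ => rfl) Polynomial.X (by simp [bits_pair]; intros; omega)) hf

theorem const (n : ℕ) : PolyTime (fun _ : α => n) :=
  of_op (.const n) (fun _ => rfl) (Polynomial.C (bits n)) (by simp)

theorem nil : PolyTime (fun _ : α => ([] : List β)) :=
  of_op (.const 0) (fun _ => rfl) (Polynomial.C (bits ([] : List β))) (by simp)

theorem cons {f : α → β} {l : α → List β} (hf : PolyTime f) (hl : PolyTime l) :
    PolyTime (fun a => f a :: l a) := by
  obtain ⟨P, p, h⟩ := hf.pair hl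
  exact ⟨P, p, h⟩

theorem true : PolyTime (fun _ : α => Bool.true) :=
  of_op (.const 1) (fun _ => rfl) (Polynomial.C (bits Bool.true)) (by simp)

theorem false : PolyTime (fun _ : α => Bool.false) :=
  of_op (.const 0) (fun _ => rfl) (Polynomial.C (bits Bool.false)) (by simp)

theorem add {f g : α → ℕ} (hf : PolyTime f) (hg : PolyTime g) : PolyTime (fun a => f a + g a) :=
  comp (g := fun x : ℕ × ℕ => x.1 + x.2)
    (of_op .add (fun _ => rfl) Polynomial.X (fun a => by
      have := size_add_le a.1 a.2; simp only [bits_pair, bits_nat, Polynomial.eval_X]; omega))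
    (hf.pair hg)

theorem sub {f g : α → ℕ} (hf : PolyTime f) (hg : PolyTime g) : PolyTime (fun a => f a - g a) :=
  comp (g := fun x : ℕ × ℕ => x.1 - x.2)
    (of_op .sub (fun _ => rfl) Polynomial.X (fun a => by
      have := Nat.size_le_size (Nat.sub_le a.1 a.2)
      simp only [bits_pair, bits_nat, Polynomial.eval_X]; omega))
    (hf.pair hg)

theorem mul {f g : α → ℕ} (hf : PolyTime f) (hg : PolyTime g) : PolyTime (fun a => f a * g a) :=
  comp (g := fun x : ℕ × ℕ => x.1 * x.2)
    (of_op .mul (fun _ => rfl) Polynomial.X (fun a => by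
      have := size_mul_le a.1 a.2; simp only [bits_pair, bits_nat, Polynomial.eval_X]; omega))
    (hf.pair hg)

theorem div {f g : α → ℕ} (hf : PolyTime f) (hg : PolyTime g) : PolyTime (fun a => f a / g a) :=
  comp (g := fun x : ℕ × ℕ => x.1 / x.2)
    (of_op .div (fun _ => rfl) Polynomial.X (fun a => by
      have := Nat.size_le_size (Nat.div_le_self a.1 a.2)
      simp only [bits_pair, bits_nat, Polynomial.eval_X]; omega))
    (hf.pair hg)

/-- Testing a number for being nonzero. -/
theorem ne_zero {f : α → ℕ} (hf : PolyTime f) : PolyTime (fun a => decide (f a ≠ 0)) := by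
  refine comp (g := fun n : ℕ => decide (n ≠ 0)) ?_ hf
  refine ⟨.ite (.op .id) (.op (.const 1)) (.op (.const 0)), 10 + 10 * Polynomial.X, fun n => ?_⟩
  simp only [Polynomial.eval_add, Polynomial.eval_mul, Polynomial.eval_ofNat, Polynomial.eval_X]
  by_cases h : n = 0
  · have h1 : enc (decide (n ≠ 0)) = (Op.const 0).apply (enc n) := by simp [h, Op.apply]
    rw [h1]
    refine ⟨_, .ite_false (by subst h; exact .op .id _) (.op _ _), ?_⟩
    subst h
    simp [Op.apply, Val.size, bits]
  · have h1 : enc (decide (n ≠ 0)) = (Op.const 1).apply (enc n) := by simp [h, Op.apply]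
    rw [h1]
    refine ⟨_, .ite_true (.op .id _) (by simpa [Op.apply] using h) (.op _ _), ?_⟩
    simp only [Op.apply, Val.size, Nat.size_one, bits, enc_nat]
    omega

theorem not {c : α → Bool} (hc : PolyTime c) : PolyTime (fun a => !c a) :=
  (by ext a; cases c a <;> rfl : (fun a => !c a) = fun a => if c a then Bool.false else Bool.true) ▸
    hc.ite .false .true

theorem and {c d : α → Bool} (hc : PolyTime c) (hd : PolyTime d) : PolyTime (fun a => c a && d a) :=
  (by ext a; cases c a <;> simp :
    (fun a => c a && d a) = fun a => if c a then d a else Bool.false) ▸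
    hc.ite hd .false

theorem or {c d : α → Bool} (hc : PolyTime c) (hd : PolyTime d) : PolyTime (fun a => c a || d a) :=
  (by ext a; cases c a <;> simp : (fun a => c a || d a) = fun a => if c a then Bool.true else d a) ▸
    hc.ite .true hd

theorem decide_le {f g : α → ℕ} (hf : PolyTime f) (hg : PolyTime g) :
    PolyTime (fun a => decide (f a ≤ g a)) :=
  (by ext a; by_cases h : f a ≤ g a <;> simp [h, Nat.sub_eq_zero_iff_le] :
    (fun a => decide (f a ≤ g a)) = fun a => !decide (f a - g a ≠ 0)) ▸ (hf.sub hg).ne_zero.not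

theorem decide_lt {f g : α → ℕ} (hf : PolyTime f) (hg : PolyTime g) :
    PolyTime (fun a => decide (f a < g a)) :=
  (by ext a; simp [Nat.sub_eq_zero_iff_le] :
    (fun a => decide (f a < g a)) = fun a => decide (g a - f a ≠ 0)) ▸ (hg.sub hf).ne_zero

theorem decide_eq {f g : α → ℕ} (hf : PolyTime f) (hg : PolyTime g) :
    PolyTime (fun a => decide (f a = g a)) :=
  (by ext a; simp [le_antisymm_iff] :
    (fun a => decide (f a = g a)) = fun a => decide (f a ≤ g a) && decide (g a ≤ f a)) ▸
    (hf.decide_le hg).and (hg.decide_le hf)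

theorem max {f g : α → ℕ} (hf : PolyTime f) (hg : PolyTime g) :
    PolyTime (fun a => Max.max (f a) (g a)) :=
  (by ext a; simp [max_def] :
    (fun a => Max.max (f a) (g a)) = fun a => if decide (f a ≤ g a) then g a else f a) ▸
    (hf.decide_le hg).ite hg hf

theorem isEmpty {l : α → List β} (hl : PolyTime l) : PolyTime (fun a => (l a).isEmpty) := by
  have h : PolyTime (fun l : List β => !l.isEmpty) :=
    of_op .isPair (by rintro (_ | _) <;> rfl) 2
      (fun l => by
        simp only [Polynomial.eval_ofNat]
        cases l <;> simp [bits, Val.size])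
  simpa using (h.comp hl).not

/-- A nonempty list is encoded as the pair of its head and tail, so the second branch runs directly
on the pair of the input and the list. -/
theorem list_cases {l : α → List β} {n : α → γ} {h : α → β → List β → γ} (hl : PolyTime l)
    (hn : PolyTime n) (hh : PolyTime (fun x : α × (β × List β) => h x.1 x.2.1 x.2.2)) :
    PolyTime (fun a => match l a with
      | [] => n a
      | b :: t => h a b t) := by
  obtain ⟨R, r, hR⟩ := hl.isEmpty
  obtain ⟨P, p, hP⟩ := hn
  obtain ⟨S, s, hS⟩ := (id (α := α)).pair hl
  obtain ⟨Q, q, hQ⟩ := hh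
  refine ⟨.ite R P (.seq S Q), 2 + Polynomial.X + r + p + s + q.comp s, fun a => ?_⟩
  obtain ⟨u, hu, hu'⟩ := hR a
  simp only [Polynomial.eval_add, Polynomial.eval_ofNat, Polynomial.eval_X, Polynomial.eval_comp]
  cases hla : l a with
  | nil =>
    obtain ⟨v, hv, hv'⟩ := hP a
    refine ⟨_, .ite_true hu (by simp [hla]) hv, ?_⟩
    unfold bits at *
    omega
  | cons b t =>
    obtain ⟨v, hv, hv'⟩ := hS a
    obtain ⟨w, hw, hw'⟩ := hQ (a, (b, t))
    have hS' : Runs S (enc a) (enc (a, (b, t))) v := by simpa [hla] using hv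
    refine ⟨_, .ite_false (by simpa [hla] using hu) (.seq hS' hw), ?_⟩
    have := hw'.trans (eval_mono q (hS'.size_le.trans hv'))
    unfold bits at *
    omega

/-- Programs only see encodings, so functions with equal encoded values share a program. -/
theorem of_enc_eq {f : α → β} {g : α → γ} (hf : PolyTime f) (h : ∀ a, enc (f a) = enc (g a)) :
    PolyTime g := by
  obtain ⟨P, p, hP⟩ := hf
  exact ⟨P, p, fun a => h a ▸ hP a⟩

/-- A loop whose states satisfy an invariant, are polynomially bounded in size, and decrease a
polynomially bounded measure. -/
theorem while_loop {σ : Type*} [Enc σ] {i : α → σ} {f : σ → σ} {c : σ → Bool} (hi : PolyTime i)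
    (hf : PolyTime f) (hc : PolyTime c) (Inv : α → σ → Prop) (μ : α → σ → ℕ) (N B : Polynomial ℕ)
    (h0 : ∀ a, Inv a (i a))
    (h1 : ∀ a s, Inv a s → c s = Bool.true → Inv a (f s) ∧ μ a (f s) < μ a s)
    (hB : ∀ a s, Inv a s → bits s ≤ B.eval (bits a)) (hN : ∀ a, μ a (i a) ≤ N.eval (bits a)) :
    ∃ g : α → σ, PolyTime g ∧ ∀ a, Inv a (g a) ∧ c (g a) = Bool.false := by
  obtain ⟨I, pi, hI⟩ := hi
  obtain ⟨P, p, hP⟩ := hf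
  obtain ⟨R, r, hR⟩ := hc
  -- Every state is bounded in terms of the original input `a`, not of the preceding state, so all
  -- rounds obey one bound and the number of rounds enters only as a factor.
  have key : ∀ (a : α) (m : ℕ) (s : σ), Inv a s → μ a s ≤ m → ∃ s' t, Inv a s' ∧ c s' = Bool.false ∧
      Runs (.loop R P) (enc s) (enc s') t ∧
      t ≤ (m + 1) *
        (1 + B.eval (bits a) + p.eval (B.eval (bits a)) + r.eval (B.eval (bits a))) := by
    intro a m
    induction m with
    | zero =>
      intro s hs hm
      have hcs : c s = Bool.false := by
        by_contra hcs
        have := (h1 a s hs (by simpa using hcs)).2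
        omega
      obtain ⟨u, hu, hu'⟩ := hR s
      refine ⟨s, _, hs, hcs, .loop_done (by simpa [hcs] using hu), ?_⟩
      have h2 := hB a s hs
      have h3 := eval_mono r h2
      unfold bits at *
      omega
    | succ m ih =>
      intro s hs hm
      obtain ⟨u, hu, hu'⟩ := hR s
      have h2 := hB a s hs
      have h3 := eval_mono r h2
      have h4 := eval_mono p h2
      rw [Nat.succ_mul]
      cases hcs : c s with
      | false =>
        refine ⟨s, _, hs, hcs, .loop_done (by simpa [hcs] using hu), ?_⟩
        unfold bits at *
        omega
      | true =>
        obtain ⟨h5, h6⟩ := h1 a s hs hcs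
        obtain ⟨s', t, h7, h8, h9, h10⟩ := ih (f s) h5 (by omega)
        obtain ⟨v, hv, hv'⟩ := hP s
        refine ⟨s', _, h7, h8, .loop_step hu (by simp [hcs]) hv h9, ?_⟩
        unfold bits at *
        omega
  choose g t hg1 hg2 hg3 hg4 using fun a => key a _ (i a) (h0 a) (hN a)
  refine ⟨g, ⟨.seq I (.loop R P), 1 + pi + (N + 1) * (1 + B + p.comp B + r.comp B), fun a => ?_⟩,
    fun a => ⟨hg1 a, hg2 a⟩⟩
  obtain ⟨u, hu, hu'⟩ := hI a
  refine ⟨_, .seq hu (hg3 a), ?_⟩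
  have := hg4 a
  simp only [Polynomial.eval_add, Polynomial.eval_one, Polynomial.eval_mul, Polynomial.eval_comp]
  unfold bits at *
  omega

/-! ### Folds and other list operations -/

/-- A loop body sees only its state, so the state carries the input along with the remaining list
and the accumulator. The values on prefixes are exactly the accumulators that occur; bounding them
excludes exponential growth. -/
theorem foldl {l : α → List β} {i : α → γ} {g : α → γ → β → γ} (hl : PolyTime l) (hi : PolyTime i)
    (hg : PolyTime (fun x : (α × γ) × β => g x.1.1 x.1.2 x.2)) (B : Polynomial ℕ)
    (hB : ∀ a l', l' <+: l a → bits (l'.foldl (g a) (i a)) ≤ B.eval (bits a)) :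
    PolyTime (fun a => (l a).foldl (g a) (i a)) := by
  obtain ⟨pl, hpl⟩ := hl.bits_le
  let f : α × (List β × γ) → α × (List β × γ) := fun s => match s.2.1 with
    | [] => s
    | b :: t => (s.1, (t, g s.1 s.2.2 b))
  have hf : PolyTime f := by
    refine list_cases (l := fun s : α × (List β × γ) => s.2.1)
      (h := fun s b t => (s.1, (t, g s.1 s.2.2 b))) id.snd.fst id ?_
    exact id.fst.fst.pair (id.snd.snd.pair
      (hg.comp ((id.fst.fst.pair id.fst.snd.snd).pair id.snd.fst)))
  obtain ⟨h, hh, hh'⟩ := while_loop (i := fun a => (a, (l a, i a))) (f := f)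
    (c := fun s => !s.2.1.isEmpty) (id.pair (hl.pair hi)) hf id.snd.fst.isEmpty.not
    (fun a s => s.1 = a ∧ ∃ l', l' ++ s.2.1 = l a ∧ s.2.2 = l'.foldl (g a) (i a))
    (fun _ s => s.2.1.length) pl (2 + Polynomial.X + pl + B)
    (fun a => ⟨rfl, [], rfl, rfl⟩)
    (by
      rintro a ⟨a', l₁, x⟩ ⟨rfl, l', h1, h2⟩ h3
      cases l₁ with
      | nil => simp at h3
      | cons b t =>
        refine ⟨⟨rfl, l' ++ [b], by simpa using h1, ?_⟩, by simp [f]⟩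
        simp only at h2
        simp [f, h2])
    (by
      rintro a ⟨a', l₁, x⟩ ⟨rfl, l', h1, h2⟩
      have h3 := hB a' l' ⟨_, h1⟩
      have h4 := hpl a'
      simp only at h1 h2
      rw [← h1] at h4
      have h5 := bits_sublist_le (List.sublist_append_right l' l₁)
      simp only [bits_pair, Polynomial.eval_add, Polynomial.eval_ofNat, Polynomial.eval_X, h2]
      omega)
    (fun a => (length_le_bits _).trans (hpl a))
  convert hh.snd.snd using 2 with a
  obtain ⟨⟨-, l', h1, h2⟩, h3⟩ := hh' a
  have h4 : (h a).2.1 = [] := by simpa using h3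
  rw [h4, List.append_nil] at h1
  rw [h2, h1]

/-- Prepending to an accumulator reverses the order. This one fold yields `reverse`, `map` and
`filter`. -/
theorem map_filter_reverse {l : α → List β} {p : α → β → Bool} {h : α → β → γ} (hl : PolyTime l)
    (hp : PolyTime (fun x : α × β => p x.1 x.2)) (hh : PolyTime (fun x : α × β => h x.1 x.2)) :
    PolyTime (fun a => (((l a).filter (p a)).map (h a)).reverse) := by
  have key : ∀ a (l : List β) (m : List γ),
      l.foldl (fun acc b => if p a b then h a b :: acc else acc) m =
        ((l.filter (p a)).map (h a)).reverse ++ m := by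
    intro a l
    induction l with
    | nil => simp
    | cons b l ih =>
      intro m
      rw [List.foldl_cons, ih]
      cases hb : p a b <;> simp [hb]
  obtain ⟨pl, hpl⟩ := hl.bits_le
  obtain ⟨ph, hph⟩ := hh.bits_le
  have := foldl (i := fun _ => ([] : List γ))
    (g := fun a acc b => if p a b then h a b :: acc else acc) hl nil
    (ite (hp.comp (id.fst.fst.pair id.snd))
      ((hh.comp (id.fst.fst.pair id.snd)).cons id.fst.snd) id.fst.snd)
    (pl * (ph.comp (Polynomial.X + pl + 1) + 1) + 1) (by
      intro a l' hl'
      rw [key, List.append_nil]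
      refine (bits_list_le (m := ph.eval (bits a + pl.eval (bits a) + 1)) ?_).trans ?_
      · intro c hc
        obtain ⟨b, hb, rfl⟩ := List.mem_map.1 (List.mem_reverse.1 hc)
        refine (hph (a, b)).trans (eval_mono _ ?_)
        have h1 := bits_le_of_mem (hl'.subset (List.mem_filter.1 hb).1)
        have h2 := hpl a
        simp only [bits_pair]
        omega
      · simp only [Polynomial.eval_add, Polynomial.eval_one, Polynomial.eval_mul,
          Polynomial.eval_comp, Polynomial.eval_X]
        gcongr
        rw [List.length_reverse, List.length_map]
        exact (List.length_filter_le _ _).trans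
          ((hl'.length_le).trans ((length_le_bits _).trans (hpl a))))
  simpa only [key, List.append_nil] using this

theorem reverse {l : α → List β} (hl : PolyTime l) : PolyTime (fun a => (l a).reverse) := by
  simpa using map_filter_reverse (p := fun _ _ => Bool.true) (h := fun _ b => b) hl true id.snd

theorem map {l : α → List β} {h : α → β → γ} (hl : PolyTime l)
    (hh : PolyTime (fun x : α × β => h x.1 x.2)) : PolyTime (fun a => (l a).map (h a)) := by
  simpa using (map_filter_reverse (p := fun _ _ => Bool.true) hl true hh).reverse

theorem filter {l : α → List β} {p : α → β → Bool} (hl : PolyTime l)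
    (hp : PolyTime (fun x : α × β => p x.1 x.2)) : PolyTime (fun a => (l a).filter (p a)) := by
  simpa using (map_filter_reverse (h := fun _ b => b) hl hp id.snd).reverse

theorem append {l m : α → List β} (hl : PolyTime l) (hm : PolyTime m) :
    PolyTime (fun a => l a ++ m a) := by
  have key : ∀ l m : List β, l.foldl (fun acc b => b :: acc) m = l.reverse ++ m := by
    intro l
    induction l <;> simp_all
  obtain ⟨pl, hpl⟩ := hl.reverse.bits_le
  obtain ⟨pm, hpm⟩ := hm.bits_le
  have := foldl (g := fun _ acc b => b :: acc) hl.reverse hm (id.snd.cons id.fst.snd)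
    (pl + pm) (by
      intro a l' hl'
      rw [key]
      have h1 := bits_append l'.reverse (m a)
      have h2 := hpm a
      have h3 := hpl a
      have h4 := bits_sublist_le hl'.sublist
      rw [bits_reverse] at h1
      simp only [Polynomial.eval_add]
      omega)
  simpa [key] using this

/-- If each step adds at most the size of the new entry plus one, the accumulator never outgrows the
start value and the list together. In particular the product of all denominators has polynomial
size. -/
theorem nat_foldl {l : α → List ℕ} {g : ℕ → ℕ → ℕ} (n : ℕ) (hl : PolyTime l)
    (hg : PolyTime (fun x : ℕ × ℕ => g x.1 x.2))
    (hB : ∀ x y, Nat.size (g x y) ≤ Nat.size x + Nat.size y + 1) :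
    PolyTime (fun a => (l a).foldl g n) := by
  obtain ⟨pl, hpl⟩ := hl.bits_le
  have key : ∀ (l : List ℕ) (m : ℕ), bits (l.foldl g m) ≤ bits m + bits l := by
    intro l
    induction l with
    | nil => simp
    | cons b l ih =>
      intro m
      have h1 := ih (g m b)
      have h2 := hB m b
      simp only [bits_nat, bits_cons, List.foldl_cons] at *
      omega
  refine foldl (g := fun _ => g) hl (const n) (hg.comp (id.fst.snd.pair id.snd))
    (Polynomial.C (bits n) + pl) fun a l' hl' => ?_
  have h1 := key l' n
  have h2 := hpl a
  have h3 := bits_sublist_le hl'.sublist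
  simp only [Polynomial.eval_add, Polynomial.eval_C]
  omega

theorem sum {l : α → List ℕ} (hl : PolyTime l) : PolyTime (fun a => (l a).sum) := by
  simpa [List.sum_eq_foldl] using hl.nat_foldl 0 (id.fst.add id.snd) size_add_le

theorem prod {l : α → List ℕ} (hl : PolyTime l) : PolyTime (fun a => (l a).prod) := by
  simpa [List.prod_eq_foldl] using hl.nat_foldl 1 (id.fst.mul id.snd)
    fun x y => (size_mul_le x y).trans (Nat.le_succ _)

theorem foldl_max {l : α → List ℕ} (hl : PolyTime l) : PolyTime (fun a => (l a).foldl Max.max 0) :=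
  hl.nat_foldl 0 (id.fst.max id.snd) fun x y => by
    rcases max_choice x y with h | h <;> rw [h] <;> omega

theorem length {l : α → List β} (hl : PolyTime l) : PolyTime (fun a => (l a).length) := by
  simpa using (hl.map (h := fun _ _ => 1) (const 1)).sum

/-- Looking up an entry of a list of numbers. -/
theorem getD {l : α → List ℕ} {n : α → ℕ} (hl : PolyTime l) (hn : PolyTime n) :
    PolyTime (fun a => (l a).getD (n a) 0) := by
  obtain ⟨pl, hpl⟩ := hl.bits_le
  -- The fold counts positions in its first component and records the entry at which the counter
  -- equals `n`.
  have key : ∀ (n : ℕ) (l : List ℕ) (i x : ℕ),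
      l.foldl (fun s b => (s.1 + 1, if decide (s.1 = n) then b else s.2)) (i, x) =
        (i + l.length, if i ≤ n ∧ n < i + l.length then l.getD (n - i) 0 else x) := by
    intro n l
    induction l with
    | nil => intro i x; simp
    | cons b l ih =>
      intro i x
      rw [List.foldl_cons, ih]
      refine Prod.ext (by simp; omega) ?_
      rcases lt_trichotomy i n with h | h | h
      · have h1 : n - i = n - (i + 1) + 1 := by omega
        have h2 : (i + 1 ≤ n ∧ n < i + 1 + l.length) ↔ (i ≤ n ∧ n < i + (b :: l).length) := by
          simp only [List.length_cons]; omega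
        simp only [h1, h2, List.getD_cons_succ, h.ne, decide_false]
        rfl
      · subst h
        simp
      · have h1 : ¬ (i + 1 ≤ n) := by omega
        have h2 : ¬ (i ≤ n) := by omega
        simp [h1, h2, h.ne']
  have h := foldl (i := fun _ => (0, 0))
    (g := fun a (s : ℕ × ℕ) b => (s.1 + 1, if decide (s.1 = n a) then b else s.2)) hl
    ((const 0).pair (const 0)) ((id.fst.snd.fst.add (const 1)).pair
      (ite (id.fst.snd.fst.decide_eq (hn.comp id.fst.fst)) id.snd id.fst.snd.snd))
    (2 * pl + 3) (by
      intro a l' hl'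
      rw [key, zero_add]
      have h1 := bits_sublist_le hl'.sublist
      have h2 := hpl a
      have h3 : bits l'.length ≤ bits l' + 1 := by
        rw [bits_nat]
        have := Nat.size_le_size (length_le_bits l')
        have h5 : Nat.size (bits l') ≤ bits l' := Nat.size_le.2 Nat.lt_two_pow_self
        omega
      have h4 : bits (if 0 ≤ n a ∧ n a < l'.length then l'.getD (n a - 0) 0 else 0) ≤ bits l' := by
        split_ifs with h
        · rw [Nat.sub_zero, List.getD_eq_getElem _ _ h.2]
          exact bits_le_of_mem (List.getElem_mem _)
        · exact bits_pos l'
      simp only [Polynomial.eval_add, Polynomial.eval_mul, Polynomial.eval_ofNat, bits_pair]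
      omega)
  convert h.snd using 2 with a
  rw [key, Nat.sub_zero, zero_add]
  split_ifs with h
  · rfl
  · rw [List.getD_eq_default _ _ (by omega)]

end PolyTime
end TreeProg

/-! Analysis of the greedy algorithm with stars, for integral costs. -/

namespace MPEMC

/-- Halving costs one binary digit; this counts the phases both in the power bound and in the
termination measure. -/
theorem size_div_two {q : ℕ} (hq : 0 < q) : Nat.size q = Nat.size (q / 2) + 1 := by
  conv_lhs => rw [← Nat.bit_bodd_div2 q]
  rw [Nat.size_bit, Nat.div2_val]
  rw [Nat.bit_bodd_div2]
  omega

section Core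

variable {V : Type*} [DecidableEq V]

/-- The residual degree bound of `v` when the edges of `J` have been chosen. -/
def residual (r : V → ℕ) (J : Finset (Sym2 V)) (v : V) : ℕ := r v - degree J v

/-- The node power for integral costs. -/
def natNodePower (c : Sym2 V → ℕ) (J : Finset (Sym2 V)) (v : V) : ℕ := (incident J v).sup c

theorem mem_incident {J : Finset (Sym2 V)} {v : V} {e : Sym2 V} :
    e ∈ incident J v ↔ e ∈ J ∧ v ∈ e := Finset.mem_filter

theorem incident_mono {J K : Finset (Sym2 V)} (h : J ⊆ K) (v : V) :
    incident J v ⊆ incident K v := Finset.filter_subset_filter _ h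

theorem incident_union (J K : Finset (Sym2 V)) (v : V) :
    incident (J ∪ K) v = incident J v ∪ incident K v := Finset.filter_union _ _ _

theorem degree_mono {J K : Finset (Sym2 V)} (h : J ⊆ K) (v : V) : degree J v ≤ degree K v :=
  Finset.card_le_card (incident_mono h v)

theorem residual_anti (r : V → ℕ) {J K : Finset (Sym2 V)} (h : J ⊆ K) (v : V) :
    residual r K v ≤ residual r J v := Nat.sub_le_sub_left (degree_mono h v) _

theorem isEdgeCover_iff {r : V → ℕ} {J : Finset (Sym2 V)} :
    IsEdgeCover r J ↔ ∀ v, residual r J v = 0 := by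
  simp [IsEdgeCover, residual, Nat.sub_eq_zero_iff_le]

theorem natNodePower_union (c : Sym2 V → ℕ) (J K : Finset (Sym2 V)) (v : V) :
    natNodePower c (J ∪ K) v = max (natNodePower c J v) (natNodePower c K v) := by
  rw [natNodePower, incident_union, Finset.sup_union]; rfl

theorem natNodePower_mono (c : Sym2 V → ℕ) {J K : Finset (Sym2 V)} (h : J ⊆ K) (v : V) :
    natNodePower c J v ≤ natNodePower c K v := Finset.sup_mono (incident_mono h v)

theorem le_natNodePower (c : Sym2 V → ℕ) {J : Finset (Sym2 V)} {v : V} {e : Sym2 V} (he : e ∈ J)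
    (hv : v ∈ e) : c e ≤ natNodePower c J v := Finset.le_sup (f := c) (mem_incident.2 ⟨he, hv⟩)

/-- The weight of `v`: the cost of the `r v`-th cheapest edge of `E` at `v`. -/
def weight (c : Sym2 V → ℕ) (r : V → ℕ) (E : Finset (Sym2 V)) (v : V) : ℕ :=
  {e ∈ incident E v | ({e' ∈ incident E v | c e' < c e}).card < r v}.sup c

/-- If an edge counted in the weight cost more than the power of `v` in `F`, all of the at least `r
v` edges of `F` at `v` would be strictly cheaper than it. -/
theorem weight_le {c : Sym2 V → ℕ} {r : V → ℕ} {E F : Finset (Sym2 V)} (hF : F ⊆ E)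
    (hr : IsEdgeCover r F) (v : V) : weight c r E v ≤ natNodePower c F v := by
  refine Finset.sup_le fun e he => ?_
  obtain ⟨he, hlt⟩ := Finset.mem_filter.1 he
  by_contra hc
  refine hlt.not_ge ((hr v).trans (Finset.card_le_card fun e' he' => ?_))
  refine Finset.mem_filter.2 ⟨incident_mono hF v he', lt_of_le_of_lt ?_ (not_le.1 hc)⟩
  exact Finset.le_sup (f := c) he'

/-- Take a cheapest unchosen edge at `v`: all strictly cheaper edges at `v` lie in `J`, and there
are fewer than `r v` of those. -/
theorem exists_edge_le_weight {c : Sym2 V → ℕ} {r : V → ℕ} {E F J : Finset (Sym2 V)} (hF : F ⊆ E)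
    (hr : IsEdgeCover r F) {v : V} (hv : 0 < residual r J v) :
    ∃ e ∈ incident E v, e ∉ J ∧ c e ≤ weight c r E v := by
  have hlt : degree J v < r v := Nat.lt_of_sub_pos hv
  have hne : (incident E v \ J).Nonempty := by
    rw [Finset.sdiff_nonempty]
    intro h
    have h1 : incident E v ⊆ incident J v := fun e he =>
      mem_incident.2 ⟨h he, (mem_incident.1 he).2⟩
    have h2 := (Finset.card_le_card (incident_mono hF v)).trans (Finset.card_le_card h1)
    have h3 := hr v
    unfold degree at *
    omega
  obtain ⟨e, he, hmin⟩ := Finset.exists_min_image _ c hne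
  obtain ⟨he, heJ⟩ := Finset.mem_sdiff.1 he
  refine ⟨e, he, heJ, Finset.le_sup (f := c) (Finset.mem_filter.2 ⟨he, lt_of_le_of_lt ?_ hlt⟩)⟩
  refine Finset.card_le_card fun e' he' => ?_
  obtain ⟨he', hc⟩ := Finset.mem_filter.1 he'
  refine mem_incident.2 ⟨?_, (mem_incident.1 he').2⟩
  by_contra h
  exact (hmin e' (Finset.mem_sdiff.2 ⟨he', h⟩)).not_gt hc

/-- The edges of a star. -/
def starEdges (a : V) (B : Finset V) : Finset (Sym2 V) := B.image fun b => s(a, b)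

theorem mem_starEdges {a : V} {B : Finset V} {e : Sym2 V} :
    e ∈ starEdges a B ↔ ∃ b ∈ B, s(a, b) = e := Finset.mem_image

/-! ### Stars, the potential and the greedy invariant -/

variable [Fintype V]

/-- The power for integral costs. -/
def natPower (c : Sym2 V → ℕ) (J : Finset (Sym2 V)) : ℕ := ∑ v, natNodePower c J v

/-- The weighted residual degree bounds. -/
def potential (w r : V → ℕ) (J : Finset (Sym2 V)) : ℕ := ∑ v, w v * residual r J v

/-- The nodes `b` that may be joined to `a` in a star of level `ℓ`. -/
def star (c : Sym2 V → ℕ) (w r : V → ℕ) (E : Finset (Sym2 V)) (q : ℕ) (J : Finset (Sym2 V))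
    (a : V) (ℓ : ℕ) : Finset V :=
  {b | s(a, b) ∈ E ∧ s(a, b) ∉ J ∧ c s(a, b) ≤ ℓ ∧ 0 < residual r J b ∧
    c s(a, b) * q ≤ w b * residual r J b}

/-- A star that is worth adding. -/
def GoodStar (c : Sym2 V → ℕ) (w r : V → ℕ) (E : Finset (Sym2 V)) (q : ℕ) (J : Finset (Sym2 V))
    (a : V) (ℓ : ℕ) : Prop :=
  (star c w r E q J a ℓ).Nonempty ∧ ℓ * q ≤ ∑ b ∈ star c w r E q J a ℓ, w b

variable {c : Sym2 V → ℕ} {w r : V → ℕ} {E F J : Finset (Sym2 V)} {q : ℕ}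

/-- For `q = 1`, a deficient node `b` has an unchosen edge `ab` of cost at most its weight. At the
level of that cost, `b` is a leaf whose weight alone makes the star at `a` good. -/
theorem isEdgeCover_of_no_goodStar (hF : F ⊆ E) (hr : IsEdgeCover r F)
    (h : ∀ a b, s(a, b) ∈ E → ¬ GoodStar c (weight c r E) r E 1 J a (c s(a, b))) :
    IsEdgeCover r J := by
  rw [isEdgeCover_iff]
  intro b
  by_contra hb
  obtain ⟨e, he, heJ, hc⟩ := exists_edge_le_weight (c := c) hF hr (Nat.pos_of_ne_zero hb)
  obtain ⟨heE, hbe⟩ := mem_incident.1 he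
  obtain ⟨a, rfl⟩ := Sym2.mem_iff_exists.1 hbe
  rw [Sym2.eq_swap] at heE heJ hc
  have hmem : b ∈ star c (weight c r E) r E 1 J a (c s(a, b)) := by
    refine Finset.mem_filter.2 ⟨Finset.mem_univ _, heE, heJ, le_rfl, Nat.pos_of_ne_zero hb, ?_⟩
    rw [mul_one]
    exact hc.trans (Nat.le_mul_of_pos_right _ (Nat.pos_of_ne_zero hb))
  refine h a b heE ⟨⟨b, hmem⟩, ?_⟩
  rw [mul_one]
  exact hc.trans (Finset.single_le_sum (f := weight c r E) (fun _ _ => Nat.zero_le _) hmem)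

/-- Write `p` for the node powers in `F`. A node with `w b * residual r J b < p b * q` is charged to
its own power. Any other deficient node distributes its potential over the edges of `F \ J` at it,
and since the star at `a` is not good, each `a` receives at most `p a * q`. -/
theorem potential_le_of_no_goodStar (hF : F ⊆ E) (hr : IsEdgeCover r F)
    (h : ∀ a b, s(a, b) ∈ E → ¬ GoodStar c w r E q J a (c s(a, b))) :
    potential w r J ≤ 2 * q * natPower c F := by
  let p := natNodePower c F
  let D : V → V → Prop := fun a b => s(a, b) ∈ F \ J ∧ 0 < residual r J b ∧
    p b * q ≤ w b * residual r J b
  classical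
  have h1 : ∀ a, ∑ b with D a b, w b ≤ p a * q := by
    intro a
    rcases Finset.eq_empty_or_nonempty (Finset.univ.filter (D a)) with h0 | ⟨b, hb⟩
    · simp [h0]
    · have hb' := (Finset.mem_filter.1 hb).2
      -- The edge of `F` attaining `p a` supplies the level; hence levels that are costs of edges at
      -- the centre suffice.
      obtain ⟨e, he, hpe⟩ := Finset.exists_mem_eq_sup (incident F a)
        ⟨s(a, b), mem_incident.2 ⟨(Finset.mem_sdiff.1 hb'.1).1, Sym2.mem_mk_left a b⟩⟩ c
      obtain ⟨heF, hae⟩ := mem_incident.1 he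
      obtain ⟨b₀, rfl⟩ := Sym2.mem_iff_exists.1 hae
      have hsub : Finset.univ.filter (D a) ⊆ star c w r E q J a (c s(a, b₀)) := by
        intro x hx
        obtain ⟨hx1, hx2, hx3⟩ := (Finset.mem_filter.1 hx).2
        obtain ⟨hx1, hx4⟩ := Finset.mem_sdiff.1 hx1
        refine Finset.mem_filter.2 ⟨Finset.mem_univ _, hF hx1, hx4, ?_, hx2, le_trans ?_ hx3⟩
        · rw [← hpe]
          exact le_natNodePower c hx1 (Sym2.mem_mk_left _ _)
        · exact Nat.mul_le_mul_right _ (le_natNodePower c hx1 (Sym2.mem_mk_right _ _))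
      have h2 : ¬ _ := fun h3 => h a b₀ (hF heF) ⟨⟨b, hsub hb⟩, h3⟩
      calc ∑ b with D a b, w b ≤ ∑ b ∈ star c w r E q J a (c s(a, b₀)), w b :=
            Finset.sum_le_sum_of_subset hsub
        _ ≤ c s(a, b₀) * q := (not_le.1 h2).le
        _ = p a * q := by rw [← hpe]; rfl
  have h2 : ∀ b, w b * residual r J b ≤ p b * q + ∑ a, if D a b then w b else 0 := by
    intro b
    by_cases hb : p b * q ≤ w b * residual r J b
    · rcases Nat.eq_zero_or_pos (residual r J b) with h0 | h0
      · simp [h0]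
      -- `F` has at least `r b` edges at `b`, so at least `residual r J b` of them are outside `J`.
      · have h3 : residual r J b ≤ (Finset.univ.filter fun a => D a b).card := by
          have h4 : incident F b ⊆ incident J b ∪
              (Finset.univ.filter fun a => D a b).image fun a => s(a, b) := by
            intro e he
            obtain ⟨heF, hbe⟩ := mem_incident.1 he
            by_cases heJ : e ∈ J
            · exact Finset.mem_union_left _ (mem_incident.2 ⟨heJ, hbe⟩)
            · obtain ⟨a, rfl⟩ := Sym2.mem_iff_exists.1 hbe
              refine Finset.mem_union_right _ (Finset.mem_image.2 ⟨a, ?_, Sym2.eq_swap⟩)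
              rw [Sym2.eq_swap] at heF heJ
              exact Finset.mem_filter.2 ⟨Finset.mem_univ _,
                Finset.mem_sdiff.2 ⟨heF, heJ⟩, h0, hb⟩
          have h5 := (Finset.card_le_card h4).trans (Finset.card_union_le _ _)
          have h6 := Finset.card_image_le (s := Finset.univ.filter fun a => D a b)
            (f := fun a => s(a, b))
          have h7 := hr b
          unfold residual degree at *
          omega
        rw [← Finset.sum_filter, Finset.sum_const, smul_eq_mul]
        exact (Nat.mul_comm _ _).le.trans
          ((Nat.mul_le_mul_right _ h3).trans (Nat.le_add_left _ _))
    · exact (not_le.1 hb).le.trans (Nat.le_add_right _ _)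
  calc potential w r J ≤ ∑ b, (p b * q + ∑ a, if D a b then w b else 0) :=
        Finset.sum_le_sum fun b _ => h2 b
    _ = ∑ b, p b * q + ∑ a, ∑ b with D a b, w b := by
        rw [Finset.sum_add_distrib, Finset.sum_comm]
        simp only [Finset.sum_filter]
    _ ≤ ∑ b, p b * q + ∑ a, p a * q := by gcongr with a; exact h1 a
    _ = 2 * q * natPower c F := by rw [← Finset.sum_mul]; simp only [natPower, p]; ring

/-- Star edges lie outside `J` and leaves are deficient, so every leaf loses at least one unit of
residual bound. -/
theorem potential_add_star_le (a : V) (ℓ : ℕ) :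
    potential w r (J ∪ starEdges a (star c w r E q J a ℓ)) + ∑ b ∈ star c w r E q J a ℓ, w b ≤
      potential w r J := by
  set B := star c w r E q J a ℓ with hB
  rw [potential, potential, ← Finset.sum_filter_add_sum_filter_not Finset.univ (· ∈ B) fun v =>
    w v * residual r J v, ← Finset.sum_filter_add_sum_filter_not Finset.univ (· ∈ B) fun v =>
    w v * residual r (J ∪ starEdges a B) v]
  have h1 : ∑ v with v ∉ B, w v * residual r (J ∪ starEdges a B) v ≤
      ∑ v with v ∉ B, w v * residual r J v :=
    Finset.sum_le_sum fun v _ => Nat.mul_le_mul_left _ (residual_anti r Finset.subset_union_left v)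
  have h2 : ∑ v with v ∈ B, w v * residual r (J ∪ starEdges a B) v + ∑ b ∈ B, w b ≤
      ∑ v with v ∈ B, w v * residual r J v := by
    rw [Finset.filter_univ_mem, ← Finset.sum_add_distrib]
    refine Finset.sum_le_sum fun b hb => ?_
    rw [← Nat.mul_succ]
    refine Nat.mul_le_mul_left _ ?_
    obtain ⟨-, -, hbJ, -, hpos, -⟩ := Finset.mem_filter.1 hb
    have h3 : incident J b ∪ {s(a, b)} ⊆ incident (J ∪ starEdges a B) b := by
      refine Finset.union_subset (incident_mono Finset.subset_union_left b) ?_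
      rw [Finset.singleton_subset_iff, mem_incident]
      exact ⟨Finset.mem_union_right _ (mem_starEdges.2 ⟨b, hb, rfl⟩), Sym2.mem_mk_right _ _⟩
    have h4 := Finset.card_le_card h3
    rw [Finset.card_union_of_disjoint (Finset.disjoint_singleton_right.2
      fun h => hbJ (mem_incident.1 h).1), Finset.card_singleton] at h4
    unfold residual degree at *
    omega
  omega

theorem natNodePower_star_le (a : V) (ℓ : ℕ) (v : V) :
    q * natNodePower c (starEdges a (star c w r E q J a ℓ)) v ≤
      (if v = a then ℓ * q else 0) + w v * residual r J v := by
  rcases Finset.eq_empty_or_nonempty (incident (starEdges a (star c w r E q J a ℓ)) v) with h0 | h0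
  · simp [natNodePower, h0]
  · obtain ⟨e, he, hpe⟩ := Finset.exists_mem_eq_sup _ h0 c
    rw [natNodePower, hpe]
    obtain ⟨he, hve⟩ := mem_incident.1 he
    obtain ⟨b, hb, rfl⟩ := mem_starEdges.1 he
    obtain ⟨-, -, -, hl, -, hq⟩ := Finset.mem_filter.1 hb
    rcases Sym2.mem_iff.1 hve with rfl | rfl
    · rw [if_pos rfl, mul_comm]
      exact (Nat.mul_le_mul_right _ hl).trans (Nat.le_add_right _ _)
    · rw [mul_comm]
      exact hq.trans (Nat.le_add_left _ _)

theorem natPower_le_add_sdiff (c : Sym2 V → ℕ) (J K : Finset (Sym2 V)) :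
    natPower c J ≤ natPower c K + natPower c (J \ K) := by
  rw [natPower, natPower, natPower, ← Finset.sum_add_distrib]
  refine Finset.sum_le_sum fun v _ => ?_
  refine (natNodePower_mono c (K := K ∪ J \ K) (by simp) v).trans ?_
  rw [natNodePower_union]
  omega

/-- The invariant of the greedy algorithm, relative to a feasible solution of power `opt`. -/
def GreedyInv (c : Sym2 V → ℕ) (w r : V → ℕ) (k opt q : ℕ) (J : Finset (Sym2 V)) : Prop :=
  (q = 0 → IsEdgeCover r J ∧ natPower c J ≤ 12 * opt * Nat.size k) ∧
  (0 < q → ∃ (J₀ : Finset (Sym2 V)) (α : V → ℕ), J₀ ⊆ J ∧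
    natPower c J₀ + 12 * opt * Nat.size q ≤ 12 * opt * Nat.size k ∧
    potential w r J₀ ≤ 6 * q * opt ∧
    (∀ v, q * natNodePower c (J \ J₀) v ≤ α v + w v * residual r J₀ v) ∧
    ∑ v, α v + potential w r J ≤ potential w r J₀)

theorem natPower_empty (c : Sym2 V → ℕ) : natPower c (∅ : Finset (Sym2 V)) = 0 := by
  simp [natPower, natNodePower, incident]

theorem GreedyInv.init {k : ℕ} (hF : F ⊆ E) (hr : IsEdgeCover r F) (hk : ∀ v, r v ≤ k) :
    GreedyInv c (weight c r E) r k (natPower c F) k ∅ := by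
  refine ⟨fun h0 => ⟨fun v => ?_, by simp [natPower_empty]⟩,
    fun h0 => ⟨∅, 0, subset_rfl, ?_, ?_, ?_, ?_⟩⟩
  -- A threshold that is zero from the start means `k = 0`: all bounds vanish and the empty set is a
  -- cover.
  · have := hk v
    omega
  · simp [natPower_empty]
  · calc potential (weight c r E) r ∅ ≤ ∑ v, natNodePower c F v * k :=
          Finset.sum_le_sum fun v _ =>
            Nat.mul_le_mul (weight_le hF hr v) ((Nat.sub_le _ _).trans (hk v))
      _ = k * natPower c F := by rw [← Finset.sum_mul, mul_comm]; rfl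
      _ ≤ 6 * k * natPower c F := by gcongr; omega
  · intro v
    simp [natNodePower, incident]
  · simp

/-- `J₀` is the edge set at the start of the phase. The function `α` collects the charges `ℓ * q` of
the centres, covered by the drop in potential. The leaf charge `w v * residual r J₀ v` serves all
stars of the phase, because power takes a maximum and residuals only decrease. -/
theorem GreedyInv.add_star {k opt : ℕ} (h : GreedyInv c w r k opt q J) (hq : 0 < q) {a : V} {ℓ : ℕ}
    (hs : GoodStar c w r E q J a ℓ) :
    GreedyInv c w r k opt q (J ∪ starEdges a (star c w r E q J a ℓ)) := by
  obtain ⟨J₀, α, h1, h2, h3, h4, h5⟩ := h.2 hq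
  refine ⟨by omega, fun _ => ⟨J₀, fun v => α v + if v = a then ℓ * q else 0,
    h1.trans Finset.subset_union_left, h2, h3, fun v => ?_, ?_⟩⟩
  · have h6 := natNodePower_mono c (J := (J ∪ starEdges a (star c w r E q J a ℓ)) \ J₀)
      (K := J \ J₀ ∪ starEdges a (star c w r E q J a ℓ)) (by
        rw [Finset.union_sdiff_distrib]
        exact Finset.union_subset_union subset_rfl Finset.sdiff_subset) v
    rw [natNodePower_union] at h6
    have h7 := h4 v
    have h8 := natNodePower_star_le (c := c) (w := w) (r := r) (E := E) (J := J) (q := q) a ℓ v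
    have h9 : w v * residual r J v ≤ w v * residual r J₀ v :=
      Nat.mul_le_mul_left _ (residual_anti r h1 v)
    refine (Nat.mul_le_mul_left q h6).trans ?_
    rcases max_choice (natNodePower c (J \ J₀) v)
      (natNodePower c (starEdges a (star c w r E q J a ℓ)) v) with h | h <;>
      rw [h] <;> beta_reduce <;> omega
  · have h6 := potential_add_star_le (c := c) (w := w) (r := r) (E := E) (J := J) (q := q) a ℓ
    have h7 := hs.2
    rw [Finset.sum_add_distrib, Finset.sum_ite_eq' Finset.univ a, if_pos (Finset.mem_univ a)]
    omega

theorem GreedyInv.halve {k : ℕ} (hF : F ⊆ E) (hr : IsEdgeCover r F)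
    (h : GreedyInv c (weight c r E) r k (natPower c F) q J) (hq : 0 < q)
    (hs : ∀ a b, s(a, b) ∈ E → ¬ GoodStar c (weight c r E) r E q J a (c s(a, b))) :
    GreedyInv c (weight c r E) r k (natPower c F) (q / 2) J := by
  obtain ⟨J₀, α, h1, h2, h3, h4, h5⟩ := h.2 hq
  set w := weight c r E
  set opt := natPower c F
  have h6 : natPower c (J \ J₀) ≤ 12 * opt := by
    -- Both the centre charges and the leaf charges total at most the potential at the start of the
    -- phase, hence the factor two from 6 to 12.
    have h7 : q * natPower c (J \ J₀) ≤ ∑ v, α v + potential w r J₀ := by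
      rw [natPower, Finset.mul_sum, potential, ← Finset.sum_add_distrib]
      exact Finset.sum_le_sum fun v _ => h4 v
    refine Nat.le_of_mul_le_mul_left (h7.trans ?_) hq
    calc ∑ v, α v + potential w r J₀ ≤ 2 * (6 * q * opt) := by omega
      _ = q * (12 * opt) := by ring
  have h7 := natPower_le_add_sdiff c J J₀
  have h8 : natPower c J + 12 * opt * Nat.size (q / 2) ≤ 12 * opt * Nat.size k := by
    rw [size_div_two hq, Nat.mul_succ] at h2
    omega
  refine ⟨fun h0 => ⟨?_, ?_⟩, fun h0 => ⟨J, 0, subset_rfl, h8, ?_, ?_, ?_⟩⟩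
  · have : q = 1 := by omega
    subst this
    exact isEdgeCover_of_no_goodStar hF hr hs
  · omega
  -- The constant 6 comes from `q ≤ 3 * (q / 2)`, valid when `q / 2` is positive and tight at `q =
  -- 3`.
  · refine (potential_le_of_no_goodStar hF hr hs).trans ?_
    gcongr ?_ * _
    omega
  · intro v
    simp [natNodePower, incident]
  · simp

end Core

end MPEMC

/-! The greedy algorithm on lists of arcs. -/

namespace MPEMC

open TreeProg

/-- An arc `(a, b)` together with its cost and the weight and the degree bound of `b`. -/
abbrev Arc : Type := (ℕ × ℕ) × (ℕ × (ℕ × ℕ))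

/-- The raw data of an instance. -/
abbrev RawInst : Type := ℕ × (List ℕ × List ((ℕ × ℕ) × (ℕ × ℕ)))

/-- The number of pairs in `J` that contain `v`. -/
def listDegree (J : List (ℕ × ℕ)) (v : ℕ) : ℕ :=
  (J.filter fun p => decide (p.1 = v) || decide (p.2 = v)).length

/-- The pairs in `J` that join `a` and `b`. -/
def listJoined (J : List (ℕ × ℕ)) (a b : ℕ) : List (ℕ × ℕ) :=
  J.filter fun p => decide (p.1 = a) && decide (p.2 = b) || decide (p.1 = b) && decide (p.2 = a)

/-- Whether the arc `y` may occur in a star. -/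
def usable (q : ℕ) (J : List (ℕ × ℕ)) (y : Arc) : Bool :=
  (listJoined J y.1.1 y.1.2).isEmpty && (decide (0 < y.2.2.2 - listDegree J y.1.2) &&
    decide (y.2.1 * q ≤ y.2.2.1 * (y.2.2.2 - listDegree J y.1.2)))

/-- The arcs that have the same first node as `x`, are at most as expensive, and are usable. -/
def listStar (L : List Arc) (q : ℕ) (J : List (ℕ × ℕ)) (x : Arc) : List Arc :=
  L.filter fun y => decide (y.1.1 = x.1.1) && (decide (y.2.1 ≤ x.2.1) && usable q J y)

/-- Whether the star given by the arc `x` is worth adding. -/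
def goodArc (L : List Arc) (q : ℕ) (J : List (ℕ × ℕ)) (x : Arc) : Bool :=
  !(listStar L q J x).isEmpty &&
    decide (x.2.1 * q ≤ ((listStar L q J x).map fun y => y.2.2.1).sum)

/-- One step of the main loop on a state `(arcs, q, J)`: add a star, or else halve `q`. -/
def greedyStep (s : List Arc × (ℕ × List (ℕ × ℕ))) : List Arc × (ℕ × List (ℕ × ℕ)) :=
  match s.1.filter (goodArc s.1 s.2.1 s.2.2) with
  | [] => (s.1, (s.2.1 / 2, s.2.2))
  | x :: _ => (s.1, (s.2.1, (listStar s.1 s.2.1 s.2.2 x).map (fun y => y.1) ++ s.2.2))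

/-- Both orientations of the edges, with the costs scaled to integers. -/
def costArcs (x : RawInst) : List ((ℕ × ℕ) × ℕ) :=
  x.2.2.map (fun e => (e.1, e.2.1 * (x.2.2.map fun e => e.2.2).prod / e.2.2)) ++
    x.2.2.map (fun e => ((e.1.2, e.1.1), e.2.1 * (x.2.2.map fun e => e.2.2).prod / e.2.2))

/-- The largest cost of an arc into `b` that has fewer than `r` cheaper arcs into `b`. -/
def listWeight (B : List ((ℕ × ℕ) × ℕ)) (r b : ℕ) : ℕ :=
  ((B.filter fun y => decide (y.1.2 = b) &&
    decide ((B.filter fun z => decide (z.1.2 = b) && decide (z.2 < y.2)).length < r)).map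
      fun y => y.2).foldl max 0

/-- The arcs of an instance with all their data. -/
def allArcs (x : RawInst) : List Arc :=
  (costArcs x).map fun y => (y.1, (y.2,
    (listWeight (costArcs x) (x.2.1.getD y.1.2 0) y.1.2, x.2.1.getD y.1.2 0)))

/-! ### The list operations of the algorithm run in polynomial time -/

section PolyTime

variable {α : Type*} [Enc α]

theorem poly_listDegree {J : α → List (ℕ × ℕ)} {v : α → ℕ} (hJ : PolyTime J) (hv : PolyTime v) :
    PolyTime fun a => listDegree (J a) (v a) :=
  (hJ.filter ((PolyTime.id.snd.fst.decide_eq (hv.comp PolyTime.id.fst)).or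
    (PolyTime.id.snd.snd.decide_eq (hv.comp PolyTime.id.fst)))).length

theorem poly_listJoined {J : α → List (ℕ × ℕ)} {u v : α → ℕ} (hJ : PolyTime J) (hu : PolyTime u)
    (hv : PolyTime v) : PolyTime fun a => listJoined (J a) (u a) (v a) :=
  hJ.filter (((PolyTime.id.snd.fst.decide_eq (hu.comp PolyTime.id.fst)).and
    (PolyTime.id.snd.snd.decide_eq (hv.comp PolyTime.id.fst))).or
    ((PolyTime.id.snd.fst.decide_eq (hv.comp PolyTime.id.fst)).and
    (PolyTime.id.snd.snd.decide_eq (hu.comp PolyTime.id.fst))))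

theorem poly_usable {q : α → ℕ} {J : α → List (ℕ × ℕ)} {y : α → Arc} (hq : PolyTime q)
    (hJ : PolyTime J)
    (hy : PolyTime y) : PolyTime fun a => usable (q a) (J a) (y a) := by
  have h := hy.snd.snd.snd.sub (poly_listDegree hJ hy.fst.snd)
  exact (poly_listJoined hJ hy.fst.fst hy.fst.snd).isEmpty.and
    (((PolyTime.const 0).decide_lt h).and ((hy.snd.fst.mul hq).decide_le (hy.snd.snd.fst.mul h)))

theorem poly_listStar {L : α → List Arc} {q : α → ℕ} {J : α → List (ℕ × ℕ)} {x : α → Arc}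
    (hL : PolyTime L) (hq : PolyTime q) (hJ : PolyTime J) (hx : PolyTime x) :
    PolyTime fun a => listStar (L a) (q a) (J a) (x a) :=
  hL.filter ((PolyTime.id.snd.fst.fst.decide_eq (hx.comp PolyTime.id.fst).fst.fst).and
    ((PolyTime.id.snd.snd.fst.decide_le (hx.comp PolyTime.id.fst).snd.fst).and
      (poly_usable (hq.comp PolyTime.id.fst) (hJ.comp PolyTime.id.fst) PolyTime.id.snd)))

theorem poly_goodArc {L : α → List Arc} {q : α → ℕ} {J : α → List (ℕ × ℕ)} {x : α → Arc}
    (hL : PolyTime L) (hq : PolyTime q) (hJ : PolyTime J) (hx : PolyTime x) :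
    PolyTime fun a => goodArc (L a) (q a) (J a) (x a) := by
  have h := poly_listStar hL hq hJ hx
  exact h.isEmpty.not.and ((hx.snd.fst.mul hq).decide_le (h.map PolyTime.id.snd.snd.snd.fst).sum)

theorem poly_greedyStep : PolyTime greedyStep := by
  have h1 : PolyTime fun s : List Arc × (ℕ × List (ℕ × ℕ)) =>
      s.1.filter (goodArc s.1 s.2.1 s.2.2) :=
    PolyTime.id.fst.filter (poly_goodArc PolyTime.id.fst.fst PolyTime.id.fst.snd.fst
      PolyTime.id.fst.snd.snd
      PolyTime.id.snd)
  have h2 := h1.list_cases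
    (h := fun s x _ =>
      (s.1, (s.2.1, (listStar s.1 s.2.1 s.2.2 x).map (fun y => y.1) ++ s.2.2)))
    (PolyTime.id.fst.pair ((PolyTime.id.snd.fst.div (PolyTime.const 2)).pair PolyTime.id.snd.snd))
    (PolyTime.id.fst.fst.pair (PolyTime.id.fst.snd.fst.pair
      (((poly_listStar PolyTime.id.fst.fst PolyTime.id.fst.snd.fst PolyTime.id.fst.snd.snd
        PolyTime.id.snd.fst).map PolyTime.id.snd.fst).append PolyTime.id.fst.snd.snd)))
  convert h2 using 2 with s
  unfold greedyStep
  cases s.1.filter (goodArc s.1 s.2.1 s.2.2) <;> rfl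

theorem poly_costArcs : PolyTime costArcs := by
  have hD : PolyTime fun x : RawInst => (x.2.2.map fun e => e.2.2).prod :=
    (PolyTime.id.snd.snd.map PolyTime.id.snd.snd.snd).prod
  have hc : PolyTime fun x : RawInst × ((ℕ × ℕ) × (ℕ × ℕ)) =>
      x.2.2.1 * (x.1.2.2.map fun e => e.2.2).prod / x.2.2.2 :=
    (PolyTime.id.snd.snd.fst.mul (hD.comp PolyTime.id.fst)).div PolyTime.id.snd.snd.snd
  exact (PolyTime.id.snd.snd.map (PolyTime.id.snd.fst.pair hc)).append
    (PolyTime.id.snd.snd.map ((PolyTime.id.snd.fst.snd.pair PolyTime.id.snd.fst.fst).pair hc))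

theorem poly_listWeight {B : α → List ((ℕ × ℕ) × ℕ)} {r b : α → ℕ} (hB : PolyTime B)
    (hr : PolyTime r)
    (hb : PolyTime b) : PolyTime fun a => listWeight (B a) (r a) (b a) := by
  have h1 : PolyTime fun x : α × ((ℕ × ℕ) × ℕ) =>
      ((B x.1).filter fun z => decide (z.1.2 = b x.1) && decide (z.2 < x.2.2)).length :=
    ((hB.comp PolyTime.id.fst).filter ((PolyTime.id.snd.fst.snd.decide_eq
      (hb.comp PolyTime.id.fst.fst)).and
      (PolyTime.id.snd.snd.decide_lt PolyTime.id.fst.snd.snd))).length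
  exact ((hB.filter ((PolyTime.id.snd.fst.snd.decide_eq (hb.comp PolyTime.id.fst)).and
    (h1.decide_lt (hr.comp PolyTime.id.fst)))).map PolyTime.id.snd.snd).foldl_max

theorem poly_allArcs : PolyTime allArcs := by
  have hr : PolyTime fun x : RawInst × ((ℕ × ℕ) × ℕ) => x.1.2.1.getD x.2.1.2 0 :=
    PolyTime.id.fst.snd.fst.getD PolyTime.id.snd.fst.snd
  exact poly_costArcs.map (PolyTime.id.snd.fst.pair (PolyTime.id.snd.snd.pair
    ((poly_listWeight (poly_costArcs.comp PolyTime.id.fst) hr PolyTime.id.snd.fst.snd).pair hr)))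

end PolyTime

end MPEMC

/-! What the lists of arcs mean for the graph. -/

namespace MPEMC

open TreeProg

/-! ### Lists of arcs versus finite edge sets -/

section Lists

variable {V : Type*} [DecidableEq V]

/-- The set of edges given by a list of pairs of nodes. -/
def edgesOf (l : List (V × V)) : Finset (Sym2 V) := (l.map fun p => s(p.1, p.2)).toFinset

/-- The numbers of a pair of nodes. -/
def numPair (ι : V → ℕ) (p : V × V) : ℕ × ℕ := (ι p.1, ι p.2)

/-- The arc given by a pair of nodes. -/
def arcOf (ι : V → ℕ) (c : Sym2 V → ℕ) (w r : V → ℕ) (p : V × V) : Arc :=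
  (numPair ι p, (c s(p.1, p.2), (w p.2, r p.2)))

theorem mem_edgesOf {l : List (V × V)} {e : Sym2 V} :
    e ∈ edgesOf l ↔ ∃ p ∈ l, s(p.1, p.2) = e := by
  simp [edgesOf]

theorem edgesOf_append (l m : List (V × V)) : edgesOf (l ++ m) = edgesOf l ∪ edgesOf m := by
  simp [edgesOf]

variable {ι : V → ℕ} {c : Sym2 V → ℕ} {w r : V → ℕ} {E : Finset (Sym2 V)} {A K : List (V × V)}

/-- Counting pairs counts edges only if no edge is listed twice, in either orientation; hence the
condition on unordered pairs. -/
theorem listDegree_eq (hι : ι.Injective) (hK : (K.map fun p => s(p.1, p.2)).Nodup) (v : V) :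
    listDegree (K.map (numPair ι)) (ι v) = degree (edgesOf K) v := by
  have h : incident (edgesOf K) v =
      ((K.map fun p => s(p.1, p.2)).filter fun e => decide (v ∈ e)).toFinset := by
    ext e
    simp [incident, edgesOf]
  rw [degree, h, List.toFinset_card_of_nodup (hK.filter _), listDegree, List.filter_map,
    List.filter_map, List.length_map, List.length_map]
  congr 1
  refine List.filter_congr fun p _ => ?_
  simp [numPair, hι.eq_iff, eq_comm]

theorem listJoined_isEmpty (hι : ι.Injective) (a b : V) :
    (listJoined (K.map (numPair ι)) (ι a) (ι b)).isEmpty = true ↔ s(a, b) ∉ edgesOf K := by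
  rw [listJoined, List.isEmpty_iff, List.filter_eq_nil_iff, mem_edgesOf]
  simp only [List.mem_map, forall_exists_index, and_imp, forall_apply_eq_imp_iff₂, numPair,
    Bool.or_eq_true, Bool.and_eq_true, decide_eq_true_eq, hι.eq_iff, not_exists, not_and,
    Sym2.eq_iff]

theorem usable_iff (hι : ι.Injective) (hK : (K.map fun p => s(p.1, p.2)).Nodup) (q : ℕ)
    (p : V × V) : usable q (K.map (numPair ι)) (arcOf ι c w r p) = true ↔
      s(p.1, p.2) ∉ edgesOf K ∧ 0 < residual r (edgesOf K) p.2 ∧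
        c s(p.1, p.2) * q ≤ w p.2 * residual r (edgesOf K) p.2 := by
  have h1 := listDegree_eq hι hK p.2
  have h2 := listJoined_isEmpty (K := K) hι p.1 p.2
  have h3 : usable q (K.map (numPair ι)) (arcOf ι c w r p) =
      ((listJoined (K.map (numPair ι)) (ι p.1) (ι p.2)).isEmpty &&
        (decide (0 < r p.2 - listDegree (K.map (numPair ι)) (ι p.2)) &&
        decide (c s(p.1, p.2) * q ≤
          w p.2 * (r p.2 - listDegree (K.map (numPair ι)) (ι p.2))))) := rfl
  rw [h3, h1]
  simp only [Bool.and_eq_true, decide_eq_true_eq, h2]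
  rfl

variable [Fintype V]

/-- The arcs of a star. -/
def starArcs (c : Sym2 V → ℕ) (w r : V → ℕ) (E : Finset (Sym2 V)) (A : List (V × V)) (q : ℕ)
    (K : List (V × V)) (x : V × V) : List (V × V) :=
  A.filter fun p => decide (p.1 = x.1 ∧
    p.2 ∈ star c w r E q (edgesOf K) x.1 (c s(x.1, x.2)))

theorem listStar_eq (hι : ι.Injective) (hA : ∀ p, p ∈ A ↔ s(p.1, p.2) ∈ E)
    (hK : (K.map fun p => s(p.1, p.2)).Nodup) (q : ℕ) (x : V × V) :
    listStar (A.map (arcOf ι c w r)) q (K.map (numPair ι)) (arcOf ι c w r x) =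
      (starArcs c w r E A q K x).map (arcOf ι c w r) := by
  rw [listStar, List.filter_map, starArcs]
  congr 1
  refine List.filter_congr fun p hp => ?_
  rw [Bool.eq_iff_iff]
  simp only [Function.comp, Bool.and_eq_true, decide_eq_true_eq, usable_iff hι hK]
  simp only [arcOf, numPair, hι.eq_iff, star, Finset.mem_filter, Finset.mem_univ, true_and]
  refine and_congr_right fun h => ?_
  rw [← h]
  have := (hA p).1 hp
  tauto

/-- All arcs of a star share their first node, so distinct arcs have distinct leaves and summing
weights over arcs counts each leaf once. -/
theorem nodup_starArcs_snd (hAn : A.Nodup) (q : ℕ) (x : V × V) :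
    ((starArcs c w r E A q K x).map Prod.snd).Nodup := by
  refine (hAn.filter _).map_on ?_
  rintro p hp p' hp' h
  have h1 := of_decide_eq_true (List.mem_filter.1 hp).2
  have h2 := of_decide_eq_true (List.mem_filter.1 hp').2
  exact Prod.ext (h1.1.trans h2.1.symm) h

theorem toFinset_starArcs_snd (hA : ∀ p, p ∈ A ↔ s(p.1, p.2) ∈ E) (q : ℕ) (x : V × V) :
    ((starArcs c w r E A q K x).map Prod.snd).toFinset =
      star c w r E q (edgesOf K) x.1 (c s(x.1, x.2)) := by
  ext b
  simp only [List.mem_toFinset, List.mem_map, starArcs, List.mem_filter, decide_eq_true_eq]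
  constructor
  · rintro ⟨p, ⟨-, -, h⟩, rfl⟩
    exact h
  · intro h
    exact ⟨(x.1, b), ⟨(hA _).2 (Finset.mem_filter.1 h).2.1, rfl, h⟩, rfl⟩

theorem edgesOf_starArcs (hA : ∀ p, p ∈ A ↔ s(p.1, p.2) ∈ E) (q : ℕ) (x : V × V) :
    edgesOf (starArcs c w r E A q K x) =
      starEdges x.1 (star c w r E q (edgesOf K) x.1 (c s(x.1, x.2))) := by
  rw [← toFinset_starArcs_snd hA]
  ext e
  simp only [mem_edgesOf, mem_starEdges, List.mem_toFinset, List.mem_map, starArcs,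
    List.mem_filter, decide_eq_true_eq]
  constructor
  · rintro ⟨p, hp, rfl⟩
    exact ⟨p.2, ⟨p, hp, rfl⟩, by rw [hp.2.1]⟩
  · rintro ⟨_, ⟨p, hp, rfl⟩, rfl⟩
    exact ⟨p, hp, by rw [hp.2.1]⟩

theorem goodArc_iff (hι : ι.Injective) (hA : ∀ p, p ∈ A ↔ s(p.1, p.2) ∈ E) (hAn : A.Nodup)
    (hK : (K.map fun p => s(p.1, p.2)).Nodup) (q : ℕ) (x : V × V) :
    goodArc (A.map (arcOf ι c w r)) q (K.map (numPair ι)) (arcOf ι c w r x) = true ↔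
      GoodStar c w r E q (edgesOf K) x.1 (c s(x.1, x.2)) := by
  have h1 : (((starArcs c w r E A q K x).map (arcOf ι c w r)).map fun y => y.2.2.1).sum =
      ∑ b ∈ star c w r E q (edgesOf K) x.1 (c s(x.1, x.2)), w b := by
    rw [← toFinset_starArcs_snd hA, List.sum_toFinset w (nodup_starArcs_snd hAn q x),
      List.map_map, List.map_map]
    rfl
  rw [goodArc, listStar_eq hι hA hK, h1, GoodStar, ← toFinset_starArcs_snd hA]
  simp only [Bool.and_eq_true, decide_eq_true_eq]
  refine and_congr ?_ Iff.rfl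
  cases starArcs c w r E A q K x <;> simp

theorem nodup_starArcs_append (hAn : A.Nodup)
    (hK : (K.map fun p => s(p.1, p.2)).Nodup) (q : ℕ) (x : V × V) :
    ((starArcs c w r E A q K x ++ K).map fun p => s(p.1, p.2)).Nodup := by
  rw [List.map_append]
  refine List.Nodup.append ?_ hK ?_
  · refine (hAn.filter _).map_on ?_
    rintro p hp p' hp' h
    have h1 := (of_decide_eq_true (List.mem_filter.1 hp).2).1
    have h2 := (of_decide_eq_true (List.mem_filter.1 hp').2).1
    rw [h1, h2] at h
    exact Prod.ext (h1.trans h2.symm) (Sym2.congr_right.1 h)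
  · intro e he he'
    obtain ⟨p, hp, rfl⟩ := List.mem_map.1 he
    obtain ⟨h1, h2⟩ := of_decide_eq_true (List.mem_filter.1 hp).2
    refine (Finset.mem_filter.1 h2).2.2.1 ?_
    rw [← h1]
    exact List.mem_toFinset.2 he'

theorem greedyStep_eq (hι : ι.Injective) (hA : ∀ p, p ∈ A ↔ s(p.1, p.2) ∈ E) (hAn : A.Nodup)
    (hK : (K.map fun p => s(p.1, p.2)).Nodup) (q : ℕ) :
    (greedyStep (A.map (arcOf ι c w r), (q, K.map (numPair ι))) =
        (A.map (arcOf ι c w r), (q / 2, K.map (numPair ι))) ∧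
      ∀ a b, s(a, b) ∈ E → ¬ GoodStar c w r E q (edgesOf K) a (c s(a, b))) ∨
    ∃ x, GoodStar c w r E q (edgesOf K) x.1 (c s(x.1, x.2)) ∧
      greedyStep (A.map (arcOf ι c w r), (q, K.map (numPair ι))) =
        (A.map (arcOf ι c w r), (q, (starArcs c w r E A q K x ++ K).map (numPair ι))) := by
  unfold greedyStep
  simp only
  cases hl : (A.map (arcOf ι c w r)).filter
      (goodArc (A.map (arcOf ι c w r)) q (K.map (numPair ι))) with
  | nil =>
    refine Or.inl ⟨rfl, fun a b hab h => ?_⟩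
    rw [List.filter_eq_nil_iff] at hl
    exact hl _ (List.mem_map_of_mem ((hA (a, b)).2 hab)) ((goodArc_iff hι hA hAn hK q (a, b)).2 h)
  | cons y t =>
    have hy : y ∈ y :: t := List.mem_cons_self
    rw [← hl, List.mem_filter] at hy
    obtain ⟨hy, hy'⟩ := hy
    obtain ⟨x, hx, rfl⟩ := List.mem_map.1 hy
    refine Or.inr ⟨x, (goodArc_iff hι hA hAn hK q x).1 hy', ?_⟩
    simp only
    rw [listStar_eq hι hA hK, List.map_map, List.map_append]
    rfl

end Lists

/-! ### Node weights computed from arcs -/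

section Weights

variable {V : Type*} [DecidableEq V] {ι : V → ℕ} {c : Sym2 V → ℕ} {E : Finset (Sym2 V)}
  {A : List (V × V)}

theorem foldl_max_eq_sup {β : Type*} [DecidableEq β] (l : List β) (c : β → ℕ) :
    (l.map c).foldl max 0 = l.toFinset.sup c := by
  have key : ∀ (l : List β) (m : ℕ), (l.map c).foldl max m = max m (l.toFinset.sup c) := by
    intro l
    induction l with
    | nil => simp
    | cons e l ih =>
      intro m
      rw [List.map_cons, List.foldl_cons, ih, List.toFinset_cons, Finset.sup_insert, max_assoc]
  simp [key]

/-- Both orientations are listed, so looking only at arcs into `b` finds every edge at `b`. -/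
theorem toFinset_arcs_at (hA : ∀ p, p ∈ A ↔ s(p.1, p.2) ∈ E) (b : V) (P : Sym2 V → Prop)
    [DecidablePred P] :
    ((A.filter fun p => decide (p.2 = b) && decide (P s(p.1, p.2))).map
      fun p => s(p.1, p.2)).toFinset = {e ∈ incident E b | P e} := by
  ext e
  simp only [List.mem_toFinset, List.mem_map, List.mem_filter, Bool.and_eq_true,
    decide_eq_true_eq, Finset.mem_filter, mem_incident]
  constructor
  · rintro ⟨p, ⟨hp, rfl, hP⟩, rfl⟩
    exact ⟨⟨(hA p).1 hp, Sym2.mem_mk_right _ _⟩, hP⟩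
  · rintro ⟨⟨he, hb⟩, hP⟩
    obtain ⟨a, rfl⟩ := Sym2.mem_iff_exists.1 hb
    rw [Sym2.eq_swap] at he hP
    exact ⟨(a, b), ⟨(hA _).2 he, rfl, hP⟩, Sym2.eq_swap⟩

theorem length_arcs_at (hA : ∀ p, p ∈ A ↔ s(p.1, p.2) ∈ E) (hAn : A.Nodup) (b : V)
    (P : Sym2 V → Prop) [DecidablePred P] :
    (A.filter fun p => decide (p.2 = b) && decide (P s(p.1, p.2))).length =
      ({e ∈ incident E b | P e}).card := by
  rw [← toFinset_arcs_at hA, List.toFinset_card_of_nodup, List.length_map]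
  refine (hAn.filter _).map_on ?_
  rintro p hp p' hp' h
  have h1 := (List.mem_filter.1 hp).2
  have h2 := (List.mem_filter.1 hp').2
  simp only [Bool.and_eq_true, decide_eq_true_eq] at h1 h2
  rw [h1.1, h2.1] at h
  exact Prod.ext (Sym2.congr_left.1 h) (h1.1.trans h2.1.symm)

theorem listWeight_eq (hι : ι.Injective) (hA : ∀ p, p ∈ A ↔ s(p.1, p.2) ∈ E) (hAn : A.Nodup)
    (r : V → ℕ) (b : V) :
    listWeight (A.map fun p => (numPair ι p, c s(p.1, p.2))) (r b) (ι b) = weight c r E b := by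
  have h1 : ∀ x : ℕ, ((A.map fun p => (numPair ι p, c s(p.1, p.2))).filter fun z =>
      decide (z.1.2 = ι b) && decide (z.2 < x)).length =
      ({e ∈ incident E b | c e < x}).card := by
    intro x
    rw [List.filter_map, List.length_map, ← length_arcs_at hA hAn b fun e => c e < x]
    simp [numPair, Function.comp_def, hι.eq_iff]
  rw [listWeight, weight, List.filter_map, ← toFinset_arcs_at hA b, ← foldl_max_eq_sup,
    List.map_map, List.map_map]
  simp only [Function.comp_def, h1]
  simp only [numPair, hι.eq_iff]

end Weights

end MPEMC

/-! The approximation algorithm. -/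

namespace MPEMC

open TreeProg

/-- The square gives room for the rounding up and is still exact at `k = 0`, so `log (k + 1)` needs
no additive constant. -/
theorem two_pow_size_le (k : ℕ) : 2 ^ Nat.size k ≤ (k + 1) ^ 2 := by
  rcases Nat.eq_zero_or_pos (Nat.size k) with h | h
  · rw [h]
    exact Nat.one_le_pow _ _ (Nat.succ_pos k)
  · obtain ⟨m, hm⟩ := Nat.exists_eq_succ_of_ne_zero h.ne'
    have h1 : 2 ^ m ≤ k := Nat.lt_size.1 (by omega)
    rw [hm, pow_succ]
    nlinarith

theorem size_le_log (k : ℕ) : (Nat.size k : ℝ) ≤ 2 / Real.log 2 * Real.log ((k : ℝ) + 1) := by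
  have h2 : 0 < Real.log 2 := Real.log_pos one_lt_two
  have h : ((2 : ℝ) ^ Nat.size k) ≤ ((k : ℝ) + 1) ^ 2 := by exact_mod_cast two_pow_size_le k
  have h' := Real.log_le_log (by positivity) h
  rw [Real.log_pow, Real.log_pow] at h'
  rw [div_mul_eq_mul_div, le_div_iff₀ h2]
  exact_mod_cast h'

/-! ### Instances as arc lists with integral costs -/

namespace Inst

variable (I : Inst)

/-- Both orientations of the edges. -/
noncomputable def darts : List (Fin I.n × Fin I.n) :=
  I.edgeList ++ I.edgeList.map fun p => (p.2, p.1)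

/-- A common multiple of the denominators of the costs. -/
noncomputable def scale : ℕ := (I.edgeList.map fun p => (I.c s(p.1, p.2)).den).prod

/-- The costs, scaled to integers. -/
noncomputable def intCost (e : Sym2 (Fin I.n)) : ℕ := (I.c e).num * I.scale / (I.c e).den

/-- The edge set as a finite set. -/
noncomputable def edges : Finset (Sym2 (Fin I.n)) := edgesOf I.darts

/-- The weights of the nodes with respect to the scaled costs. -/
noncomputable def nodeWeight : Fin I.n → ℕ := weight I.intCost I.r I.edges

/-- The data that are encoded in the input. -/
noncomputable def raw : RawInst :=
  (I.n, ((List.finRange I.n).map I.r,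
    I.edgeList.map fun p => (numPair Fin.val p, ((I.c s(p.1, p.2)).num, (I.c s(p.1, p.2)).den))))

/-- The arcs of the instance with all their data. -/
noncomputable def arcs : List Arc :=
  I.darts.map (arcOf Fin.val I.intCost I.nodeWeight I.r)

variable {I}

theorem mem_edgeList {p : Fin I.n × Fin I.n} :
    p ∈ I.edgeList ↔ p.1 < p.2 ∧ I.G.Adj p.1 p.2 := by
  simp only [edgeList, List.mem_filter, decide_eq_true_eq, and_iff_right_iff_imp]
  intro
  exact List.mem_product.2 ⟨List.mem_finRange _, List.mem_finRange _⟩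

theorem mem_darts {p : Fin I.n × Fin I.n} : p ∈ I.darts ↔ I.G.Adj p.1 p.2 := by
  simp only [darts, List.mem_append, List.mem_map, mem_edgeList]
  constructor
  · rintro (h | ⟨p', h, rfl⟩)
    · exact h.2
    · exact h.2.symm
  · intro h
    rcases lt_trichotomy p.1 p.2 with h1 | h1 | h1
    · exact Or.inl ⟨h1, h⟩
    · exact absurd h1 h.ne
    · exact Or.inr ⟨(p.2, p.1), ⟨h1, h.symm⟩, rfl⟩

theorem mem_edges {e : Sym2 (Fin I.n)} : e ∈ I.edges ↔ e ∈ I.G.edgeSet := by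
  rw [edges, mem_edgesOf]
  constructor
  · rintro ⟨p, hp, rfl⟩
    exact mem_darts.1 hp
  · induction e with
    | _ a b => exact fun h => ⟨(a, b), mem_darts.2 h, rfl⟩

theorem mem_darts_iff (p : Fin I.n × Fin I.n) : p ∈ I.darts ↔ s(p.1, p.2) ∈ I.edges := by
  rw [mem_darts, mem_edges, SimpleGraph.mem_edgeSet]

theorem nodup_darts : I.darts.Nodup := by
  have h : I.edgeList.Nodup := ((List.nodup_finRange _).product (List.nodup_finRange _)).filter _
  refine List.Nodup.append h (h.map ?_) ?_
  · rintro p q hpq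
    simp only [Prod.mk.injEq] at hpq
    exact Prod.ext hpq.2 hpq.1
  · intro p hp hp'
    obtain ⟨q, hq, rfl⟩ := List.mem_map.1 hp'
    exact (mem_edgeList.1 hp).1.not_gt (mem_edgeList.1 hq).1

theorem subset_edges {F : Finset (Sym2 (Fin I.n))} (hF : I.IsSolution F) : F ⊆ I.edges :=
  fun _ he => mem_edges.2 (hF.1 he)

theorem scale_pos : 0 < I.scale := by
  refine List.prod_pos fun d hd => ?_
  obtain ⟨p, -, rfl⟩ := List.mem_map.1 hd
  exact NNRat.den_pos _

/-- The rounded division is exact on edges of the graph, because their denominators are factors of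
`scale`. -/
theorem intCost_cast {e : Sym2 (Fin I.n)} (he : e ∈ I.edges) :
    (I.intCost e : ℚ≥0) = I.scale * I.c e := by
  have hd : (I.c e).den ∣ I.scale := by
    obtain ⟨p, hp, rfl⟩ := mem_edgesOf.1 he
    rcases List.mem_append.1 hp with hp | hp
    · exact List.dvd_prod (List.mem_map.2 ⟨p, hp, rfl⟩)
    · obtain ⟨p', hp', rfl⟩ := List.mem_map.1 hp
      rw [Sym2.eq_swap]
      exact List.dvd_prod (List.mem_map.2 ⟨p', hp', rfl⟩)
  have h0 : ((I.c e).den : ℚ≥0) ≠ 0 := Nat.cast_ne_zero.2 (NNRat.den_ne_zero _)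
  rw [intCost, Nat.cast_div (hd.mul_left _) h0, Nat.cast_mul]
  conv_rhs => rw [← NNRat.num_div_den (I.c e)]
  field_simp

theorem natPower_cast {J : Finset (Sym2 (Fin I.n))} (hJ : J ⊆ I.edges) :
    (natPower I.intCost J : ℚ≥0) = I.scale * power I.c J := by
  rw [natPower, power, Finset.mul_sum, Nat.cast_sum]
  refine Finset.sum_congr rfl fun v _ => ?_
  rw [natNodePower, nodePower,
    Finset.apply_sup_eq_sup_comp_of_linearOrder (fun n : ℕ => (n : ℚ≥0)) Nat.mono_cast (by simp),
    Finset.apply_sup_eq_sup_comp_of_linearOrder (fun x : ℚ≥0 => (I.scale : ℚ≥0) * x)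
      (fun x y h => mul_le_mul_right h _) (by simp)]
  exact Finset.sup_congr rfl fun e he => intCost_cast (hJ (mem_incident.1 he).1)

theorem costArcs_raw :
    costArcs I.raw = I.darts.map fun p => (numPair Fin.val p, I.intCost s(p.1, p.2)) := by
  rw [costArcs, darts, List.map_append, raw]
  simp only [List.map_map]
  congr 1
  refine List.map_congr_left fun p _ => ?_
  simp only [Function.comp, Sym2.eq_swap (a := p.2)]
  rfl

theorem allArcs_raw : allArcs I.raw = I.arcs := by
  rw [allArcs, costArcs_raw, List.map_map, arcs]
  refine List.map_congr_left fun p _ => ?_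
  have h : I.raw.2.1.getD (p.2 : ℕ) 0 = I.r p.2 := by
    simp [raw]
  have h' : listWeight (I.darts.map fun p => (numPair Fin.val p, I.intCost s(p.1, p.2))) (I.r p.2)
      (p.2 : ℕ) = I.nodeWeight p.2 :=
    listWeight_eq Fin.val_injective mem_darts_iff nodup_darts I.r p.2
  rw [arcOf, ← h', ← h]
  rfl

theorem foldl_max_raw : I.raw.2.1.foldl max 0 = I.k := by
  rw [raw, foldl_max_eq_sup, k]
  congr 1
  ext v
  simp

end Inst

noncomputable instance : Enc Inst := ⟨Inst.encode⟩

/-- An instance and its raw data have the same encoding, so the identity program suffices. -/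
theorem polyTime_raw : PolyTime Inst.raw := by
  refine PolyTime.of_enc_eq PolyTime.id fun I => ?_
  change I.encode = Val.pair _ (Val.pair (Val.ofList _) (Val.ofList _))
  simp only [Inst.raw, List.map_map]
  rfl

/-- The invariant of the main loop. -/
def LoopInv (I : Inst) (s : List Arc × (ℕ × List (ℕ × ℕ))) : Prop :=
  ∃ K : List (Fin I.n × Fin I.n), s.1 = I.arcs ∧ s.2.1 ≤ I.k ∧ s.2.2 = K.map (numPair Fin.val) ∧
    (K.map fun p => s(p.1, p.2)).Nodup ∧ K ⊆ I.darts ∧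
    ∀ F, I.IsSolution F →
      GreedyInv I.intCost I.nodeWeight I.r I.k (natPower I.intCost F) s.2.1 (edgesOf K)

theorem LoopInv.init (I : Inst) : LoopInv I (I.arcs, (I.k, [])) :=
  ⟨[], rfl, le_rfl, rfl, List.nodup_nil, List.nil_subset _, fun _ hF =>
    GreedyInv.init (Inst.subset_edges hF) hF.2 fun v => Finset.le_sup (Finset.mem_univ v)⟩

/-- The chosen arcs are distinct members of `darts`. This keeps the truncated difference of lengths
in the termination measure meaningful. -/
theorem LoopInv.length_le {I : Inst} {s : List Arc × (ℕ × List (ℕ × ℕ))} (h : LoopInv I s) :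
    s.2.2.length ≤ s.1.length := by
  obtain ⟨K, h1, -, h3, h4, h5, -⟩ := h
  rw [h1, h3, Inst.arcs, List.length_map, List.length_map]
  exact ((List.Nodup.of_map _ h4).subperm h5).length_le

theorem LoopInv.step {I : Inst} {s : List Arc × (ℕ × List (ℕ × ℕ))} (h : LoopInv I s)
    (hq : s.2.1 ≠ 0) : LoopInv I (greedyStep s) ∧
      (greedyStep s).1.length - (greedyStep s).2.2.length + Nat.size (greedyStep s).2.1 <
        s.1.length - s.2.2.length + Nat.size s.2.1 := by
  obtain ⟨L, q, J⟩ := s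
  obtain ⟨K, h1, h2, h3, h4, h5, h6⟩ := h
  simp only at h1 h2 h3 h4 h6 hq ⊢
  subst h1 h3
  have hq' := Nat.pos_of_ne_zero hq
  rcases greedyStep_eq (c := I.intCost) (w := I.nodeWeight) (r := I.r) Fin.val_injective
    Inst.mem_darts_iff Inst.nodup_darts h4 q with ⟨h7, h8⟩ | ⟨x, h7, h8⟩
  · rw [← Inst.arcs] at h7
    rw [h7]
    refine ⟨⟨K, rfl, (Nat.div_le_self _ _).trans h2, rfl, h4, h5, fun F hF =>
      (h6 F hF).halve (Inst.subset_edges hF) hF.2 hq' h8⟩, ?_⟩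
    refine Nat.add_lt_add_left ?_ _
    rw [size_div_two hq']
    exact Nat.lt_succ_self _
  · rw [← Inst.arcs] at h8
    rw [h8]
    have h9 : LoopInv I (I.arcs, (q, (starArcs I.intCost I.nodeWeight I.r I.edges I.darts q K x ++
        K).map (numPair Fin.val))) := by
      refine ⟨_, rfl, h2, rfl, nodup_starArcs_append Inst.nodup_darts h4 q x,
        List.append_subset.2 ⟨List.filter_subset_self _, h5⟩, fun F hF => ?_⟩
      rw [edgesOf_append, Finset.union_comm, edgesOf_starArcs Inst.mem_darts_iff]
      exact (h6 F hF).add_star hq' h7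
    refine ⟨h9, Nat.add_lt_add_right ?_ _⟩
    have h10 := h9.length_le
    -- Nonemptiness is part of `GoodStar` so that every addition makes progress, even at level zero.
    have h11 : 0 < (starArcs I.intCost I.nodeWeight I.r I.edges I.darts q K x).length := by
      have := h7.1
      rw [← toFinset_starArcs_snd Inst.mem_darts_iff] at this
      rw [List.length_pos_iff]
      intro h
      simp [h] at this
    simp only [List.length_map, List.length_append] at h10 ⊢
    omega

theorem LoopInv.power_le {I : Inst} {K : List (Fin I.n × Fin I.n)} (hK : K ⊆ I.darts)
    {F : Finset (Sym2 (Fin I.n))} (hF : I.IsSolution F)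
    (h : natPower I.intCost (edgesOf K) ≤ 12 * natPower I.intCost F * Nat.size I.k) :
    (power I.c (edgesOf K) : ℝ) ≤
      24 / Real.log 2 * Real.log ((I.k : ℝ) + 1) * (power I.c F : ℝ) := by
  have hKE : edgesOf K ⊆ I.edges := by
    intro e he
    obtain ⟨p, hp, rfl⟩ := mem_edgesOf.1 he
    exact (Inst.mem_darts_iff p).1 (hK hp)
  have h1 : (natPower I.intCost (edgesOf K) : ℚ≥0) ≤ 12 * natPower I.intCost F * Nat.size I.k := by
    exact_mod_cast h
  rw [Inst.natPower_cast hKE, Inst.natPower_cast (Inst.subset_edges hF)] at h1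
  have h2 : (I.scale : ℝ) * power I.c (edgesOf K) ≤
      12 * (I.scale * power I.c F) * Nat.size I.k := by
    exact_mod_cast (NNRat.cast_le (K := ℝ)).2 h1
  have h3 : (0 : ℝ) < I.scale := Nat.cast_pos.2 Inst.scale_pos
  have h4 : (power I.c (edgesOf K) : ℝ) ≤ 12 * power I.c F * Nat.size I.k := by
    refine le_of_mul_le_mul_left ?_ h3
    linarith
  have h5 : (0 : ℝ) ≤ 12 * power I.c F := by positivity
  refine h4.trans ((mul_le_mul_of_nonneg_left (size_le_log I.k) h5).trans (le_of_eq ?_))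
  ring

/-- The algorithm never sees a solution: the invariant speaks of all of them at once, and the
measure of none, so the loop also halts on infeasible instances. -/
theorem exists_greedy : ∃ g : Inst → List Arc × (ℕ × List (ℕ × ℕ)), PolyTime g ∧
    ∀ I, LoopInv I (g I) ∧ (g I).2.1 = 0 := by
  have hA : PolyTime Inst.arcs := by
    simpa only [Inst.allArcs_raw] using poly_allArcs.comp polyTime_raw
  have hk : PolyTime Inst.k := by
    simpa only [Inst.foldl_max_raw] using polyTime_raw.snd.fst.foldl_max
  obtain ⟨pA, hpA⟩ := hA.bits_le
  obtain ⟨pk, hpk⟩ := hk.bits_le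
  obtain ⟨g, hg, hg'⟩ := PolyTime.while_loop
    (i := fun I : Inst => (I.arcs, (I.k, ([] : List (ℕ × ℕ)))))
    (c := fun s => decide (s.2.1 ≠ 0)) (hA.pair (hk.pair .nil)) poly_greedyStep
    PolyTime.id.snd.fst.ne_zero LoopInv
    (fun _ s => s.1.length - s.2.2.length + Nat.size s.2.1) (pA + pk)
    (pA + (pk + (pA * (pA + 1) + 1) + 1) + 1) LoopInv.init
    (fun I s h hs => h.step (of_decide_eq_true hs))
    (fun I s h => by
      have hlen := h.length_le
      obtain ⟨K, h1, h2, h3, -, h5, -⟩ := h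
      have h6 := hpA I
      have h7 := hpk I
      have h8 : bits s.2.1 ≤ bits I.k := Nat.add_le_add_right (Nat.size_le_size h2) 1
      -- Every chosen pair is the first component of some arc, so the arc list bounds its size.
      have h9 : bits s.2.2 ≤ s.2.2.length * (pA.eval (bits I) + 1) + 1 := by
        refine bits_list_le fun p hp => ?_
        rw [h3] at hp
        obtain ⟨p, hpK, rfl⟩ := List.mem_map.1 hp
        have h10 : arcOf Fin.val I.intCost I.nodeWeight I.r p ∈ I.arcs :=
          List.mem_map_of_mem (h5 hpK)
        have h11 := bits_le_of_mem h10
        rw [bits_pair] at h11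
        have h12 : bits (arcOf Fin.val I.intCost I.nodeWeight I.r p).1 =
          bits (numPair Fin.val p) := rfl
        omega
      have h10 : s.2.2.length * (pA.eval (bits I) + 1) ≤
          pA.eval (bits I) * (pA.eval (bits I) + 1) := by
        refine Nat.mul_le_mul_right _ (hlen.trans ?_)
        rw [h1]
        exact (length_le_bits _).trans h6
      rw [← h1] at h6
      rw [bits_pair, bits_pair]
      simp only [Polynomial.eval_add, Polynomial.eval_one, Polynomial.eval_mul]
      omega)
    (fun I => by
      have h1 := hpA I
      have h2 := hpk I
      have h3 := length_le_bits I.arcs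
      rw [bits_nat] at h2
      simp only [Polynomial.eval_add]
      omega)
  exact ⟨g, hg, fun I => ⟨(hg' I).1, by simpa using (hg' I).2⟩⟩

end MPEMC

theorem theorem1 :
    ∃ (C : ℝ) (P : TreeProg.Prog), 0 < C ∧
      MPEMC.IsPolyTimeApprox P (fun I => C * Real.log ((I.k : ℝ) + 1)) := by
  obtain ⟨g, hg, hg'⟩ := MPEMC.exists_greedy
  obtain ⟨P, p, hP⟩ := hg.snd.snd
  -- Twelve from each phase, times `2 / log 2` from bounding the number `Nat.size k` of phases.
  refine ⟨24 / Real.log 2, P, div_pos (by norm_num) (Real.log_pos one_lt_two), p, fun I => ?_⟩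
  obtain ⟨t, ht, hpt⟩ := hP I
  refine ⟨_, t, ht, hpt, ?_⟩
  rintro ⟨F, hF⟩
  obtain ⟨⟨K, -, -, h3, -, h5, h6⟩, h0⟩ := hg' I
  rw [h0] at h6
  refine ⟨K, ?_, MPEMC.edgesOf K, rfl, ⟨fun e he => ?_, ((h6 F hF).1 rfl).1⟩, fun F hF =>
    MPEMC.LoopInv.power_le h5 hF ((h6 F hF).1 rfl).2⟩
  · beta_reduce
    rw [h3, MPEMC.encodeEdges]
    change TreeProg.Val.ofList _ = _
    rw [List.map_map]
    rfl
  · obtain ⟨q, hq, rfl⟩ := MPEMC.mem_edgesOf.1 he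
    exact MPEMC.Inst.mem_darts.1 (h5 hq)
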